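/- Let $H$ be a separable complex Hilbert space and let $A$ be a self-adjoint operator in $H$ with $A\ge\lambda_0 E$ for some $\lambda_0>0$, where $E$ is the identity operator. For $\kappa\in\mathbb R$ let $L_{2,\kappa}(\mathbb R_+;H)$ be the space of (classes of) measurable functions $f:\mathbb R_+=[0,\infty)\to H$ with finite norm $$\|f\|_{L_{2,\kappa}}=\Big(\int_0^\infty\|f(t)\|_H^2\,e^{-\kappa t}\,dt\Big)^{1/2},$$ let $W^4_{2,\kappa}(\mathbb R_+;H)$ be the space of all functions $u$ with $\frac{d^4u}{dt^4}\in L_{2,\kappa}(\mathbb R_+;H)$ (derivative in the sense of generalized functions) and $A^4u\in L_{2,\kappa}(\mathbb R_+;H)$, with the norm $$\|u\|_{W^4_{2,\kappa}}=\Big(\Big\|\frac{d^4u}{dt^4}\Big\|_{L_{2,\kappa}}^2+\|A^4u\|_{L_{2,\kappa}}^2\Big)^{1/2},$$ and let $\overset{\circ}{W}{}^4_{2,\kappa}(\mathbb R_+;H)$ be its subspace of all $u$ with $u(0)=u'(0)=u''(0)=0$. If $|\kappa|<2\lambda_0$, then the operator $$P_0u=\Big(-\frac{d}{dt}+A\Big)\Big(\frac{d}{dt}+A\Big)^3u$$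 is defined on all of $\overset{\circ}{W}{}^4_{2,\kappa}(\mathbb R_+;H)$ and maps this space isomorphically onto $L_{2,\kappa}(\mathbb R_+;H)$; that is, it is a bounded linear bijection between these spaces with bounded inverse. -/

import Mathlib

open MeasureTheory Set Filter Topology
open scoped ContDiff ENNReal

noncomputable section

namespace WeightedODE

/-! ### Partially defined operators -/

section Operators

variable {E : Type*} [AddCommGroup E] [Module ℂ E]

/-- Product `g f` of two partially defined operators, with its natural domain
`{x ∈ D(f) | f x ∈ D(g)}`. -/
def opComp (g f : E →ₗ.[ℂ] E) : E →ₗ.[ℂ] E where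
  domain := (g.domain.comap f.toFun).map f.domain.subtype
  toFun :=
    { toFun := fun x => g ⟨f ⟨x.1, by
          obtain ⟨y, _, hyx⟩ := x.2
          exact hyx ▸ y.2⟩, by
          obtain ⟨x, y, hy, rfl⟩ := x
          exact hy⟩
      map_add' := fun x y => by
        rw [← g.map_add]
        congr 1
        ext
        simp only [Submodule.coe_add]
        rw [← f.map_add]
        rfl
      map_smul' := fun c x => by
        rw [RingHom.id_apply, ← g.map_smul]
        congr 1
        ext
        simp only [Submodule.coe_smul]
        rw [← f.map_smul]
        rfl }

/-- Powers of a partially defined operator: `T ^ 0 = 1` on the whole space and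
`T ^ (n + 1) = T (T ^ n)`, with natural domains. -/
def opPow (T : E →ₗ.[ℂ] E) : ℕ → (E →ₗ.[ℂ] E)
  | 0 => LinearMap.id.toPMap ⊤
  | n + 1 => opComp T (opPow T n)

theorem mem_opComp_graph (g f : E →ₗ.[ℂ] E) (x z : E) :
    (x, z) ∈ (opComp g f).graph ↔ ∃ y, (x, y) ∈ f.graph ∧ (y, z) ∈ g.graph := by
  simp only [LinearPMap.mem_graph_iff]
  constructor
  · rintro ⟨⟨_, ⟨a, ha, rfl⟩⟩, rfl, rfl⟩
    exact ⟨f a, ⟨a, rfl, rfl⟩, ⟨f a, ha⟩, rfl, rfl⟩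
  · rintro ⟨_, ⟨a, rfl, rfl⟩, ⟨b, hb, rfl⟩⟩
    have ha : f a ∈ g.domain := hb ▸ b.2
    refine ⟨⟨a.1, ⟨a, ha, rfl⟩⟩, rfl, ?_⟩
    change g ⟨f a, ha⟩ = g b
    congr 1
    exact Subtype.ext hb.symm

end Operators

/-! ### The weighted space `L_{2,κ}(ℝ₊; H)` -/

/-- The measure `e^{-κ t} dt` on the half-line `(0, ∞)`. -/
def wMeasure (κ : ℝ) : Measure ℝ :=
  (volume.restrict (Ioi 0)).withDensity fun t => ENNReal.ofReal (Real.exp (-κ * t))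

/-- `L_{2,κ}(ℝ₊; H)`, with norm `(∫₀^∞ ‖f(t)‖² e^{-κ t} dt)^{1/2}`. -/
abbrev L2w (κ : ℝ) (H : Type*) [NormedAddCommGroup H] : Type _ := Lp H 2 (wMeasure κ)

/-- Test functions: smooth, with compact support in the open half-line `(0, ∞)`. -/
def IsTest (φ : ℝ → ℝ) : Prop :=
  ContDiff ℝ ∞ φ ∧ HasCompactSupport φ ∧ tsupport φ ⊆ Ioi 0

variable {H : Type*} [NormedAddCommGroup H] [InnerProductSpace ℂ H]

theorem ae_wMeasure_iff (κ : ℝ) {p : ℝ → Prop} :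
    (∀ᵐ t ∂wMeasure κ, p t) ↔ ∀ᵐ t ∂(volume.restrict (Ioi (0 : ℝ))), p t := by
  rw [wMeasure, ae_withDensity_iff (by fun_prop)]
  simp [Real.exp_pos]

theorem integrable_smul_L2w {κ : ℝ} {ψ : ℝ → ℝ} (hψ : Continuous ψ) (hc : HasCompactSupport ψ)
    (u : L2w κ H) : Integrable (fun t => ψ t • u t) (volume.restrict (Ioi 0)) := by
  have : IsLocallyFiniteMeasure (wMeasure κ) := by
    unfold wMeasure
    exact IsLocallyFiniteMeasure.withDensity_coe
      (f := fun t => Real.toNNReal (Real.exp (-κ * t))) (by fun_prop)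
  have hχ : Continuous fun t => Real.exp (κ * t) * ψ t := by fun_prop
  have h1 : MemLp (fun t => Real.exp (κ * t) * ψ t) 2 (wMeasure κ) :=
    hχ.memLp_of_hasCompactSupport hc.mul_left
  suffices key : ∀ f : ℝ → H, MemLp f 2 (wMeasure κ) →
      Integrable (fun t => ψ t • f t) (volume.restrict (Ioi 0)) from key _ (Lp.memLp u)
  intro f hu
  have h2 : Integrable (fun t => (Real.exp (κ * t) * ψ t) • f t) (wMeasure κ) :=
    memLp_one_iff_integrable.mp (MemLp.smul (𝕜 := ℝ) (p := 2) (q := 2) (r := 1) hu h1)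
  have hm : Measurable fun t : ℝ => ENNReal.ofReal (Real.exp (-κ * t)) := by fun_prop
  rw [wMeasure, integrable_withDensity_iff_integrable_smul' hm (by simp)] at h2
  refine h2.congr (ae_of_all _ fun t => ?_)
  simp only [ENNReal.toReal_ofReal (Real.exp_pos _).le, smul_smul]
  rw [← mul_assoc, ← Real.exp_add]
  simp

/-! ### Generalized derivatives in `L_{2,κ}(ℝ₊; H)` -/

theorem IsTest.continuous_iteratedDeriv {φ : ℝ → ℝ} (h : IsTest φ) (n : ℕ) :
    Continuous (iteratedDeriv n φ) :=
  h.1.continuous_iteratedDeriv n (mod_cast le_top)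

theorem IsTest.hasCompactSupport_iteratedDeriv {φ : ℝ → ℝ} (h : IsTest φ) (n : ℕ) :
    HasCompactSupport (iteratedDeriv n φ) := by
  induction n with
  | zero => simpa using h.2.1
  | succ n ih => rw [iteratedDeriv_succ]; exact ih.deriv

/-- Pairs `(u, g)` in `L_{2,κ}` such that `g` is the `n`-th derivative of `u` on `(0, ∞)` in the
sense of generalized functions: `∫ φ⁽ⁿ⁾ u = (-1)ⁿ ∫ φ g` for all test functions `φ`. -/
def weakDerivGraph (κ : ℝ) (H : Type*) [NormedAddCommGroup H] [InnerProductSpace ℂ H] (n : ℕ) :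
    Submodule ℂ (L2w κ H × L2w κ H) where
  carrier := {p | ∀ φ : ℝ → ℝ, IsTest φ →
    ∫ t in Ioi 0, iteratedDeriv n φ t • p.1 t = (-1 : ℝ) ^ n • ∫ t in Ioi 0, φ t • p.2 t}
  zero_mem' := fun φ _ => by
    have h : ∀ ψ : ℝ → ℝ, ∫ t in Ioi 0, ψ t • (0 : L2w κ H) t = 0 := fun ψ => by
      rw [← integral_zero (α := ℝ) (G := H) (μ := volume.restrict (Ioi 0))]
      refine integral_congr_ae ?_
      filter_upwards [(ae_wMeasure_iff κ).mp (Lp.coeFn_zero H 2 (wMeasure κ))] with t ht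
      rw [ht, Pi.zero_apply, smul_zero]
    rw [Prod.fst_zero, Prod.snd_zero, h, h, smul_zero]
  add_mem' := fun {p q} hp hq φ hφ => by
    have h : ∀ (ψ : ℝ → ℝ) (v w : L2w κ H), Continuous ψ → HasCompactSupport ψ →
        ∫ t in Ioi 0, ψ t • (v + w) t
          = (∫ t in Ioi 0, ψ t • v t) + ∫ t in Ioi 0, ψ t • w t := fun ψ v w hψ hc => by
      rw [← integral_add (integrable_smul_L2w hψ hc v) (integrable_smul_L2w hψ hc w)]
      refine integral_congr_ae ?_
      filter_upwards [(ae_wMeasure_iff κ).mp (Lp.coeFn_add v w)] with t ht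
      rw [ht, Pi.add_apply, smul_add]
    rw [Prod.fst_add, Prod.snd_add,
      h _ _ _ (hφ.continuous_iteratedDeriv n) (hφ.hasCompactSupport_iteratedDeriv n),
      h _ _ _ hφ.1.continuous hφ.2.1, smul_add, hp φ hφ, hq φ hφ]
  smul_mem' := fun c p hp φ hφ => by
    have h : ∀ (ψ : ℝ → ℝ) (v : L2w κ H),
        ∫ t in Ioi 0, ψ t • (c • v) t = c • ∫ t in Ioi 0, ψ t • v t := fun ψ v => by
      rw [← integral_smul]
      refine integral_congr_ae ?_
      filter_upwards [(ae_wMeasure_iff κ).mp (Lp.coeFn_smul c v)] with t ht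
      simp only [ht, Pi.smul_apply]
      rw [smul_comm]
    rw [Prod.smul_fst, Prod.smul_snd, h, h, hp φ hφ, smul_comm]

/-- The operator `dⁿ/dtⁿ` in `L_{2,κ}(ℝ₊; H)`, with domain all `u` whose generalized `n`-th
derivative is in `L_{2,κ}`. -/
def weakDeriv (κ : ℝ) (H : Type*) [NormedAddCommGroup H] [InnerProductSpace ℂ H] (n : ℕ) :
    L2w κ H →ₗ.[ℂ] L2w κ H :=
  (weakDerivGraph κ H n).toLinearPMap

/-- The operator `u ↦ T u(·)` in `L_{2,κ}(ℝ₊; H)`: pairs `(u, h)` with `u(t) ∈ D(T)` and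
`h(t) = T u(t)` for almost every `t`. -/
def pointwiseGraph (κ : ℝ) (T : H →ₗ.[ℂ] H) : Submodule ℂ (L2w κ H × L2w κ H) where
  carrier := {p | ∀ᵐ t ∂wMeasure κ, (p.1 t, p.2 t) ∈ T.graph}
  zero_mem' := by
    change ∀ᵐ t ∂wMeasure κ, _
    filter_upwards [Lp.coeFn_zero H 2 (wMeasure κ)] with t ht
    rw [Prod.fst_zero, Prod.snd_zero, ht]
    exact T.graph.zero_mem
  add_mem' := fun {p q} hp hq => by
    change ∀ᵐ t ∂wMeasure κ, _
    filter_upwards [hp, hq, Lp.coeFn_add p.1 q.1, Lp.coeFn_add p.2 q.2] with t h1 h2 h3 h4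
    rw [Prod.fst_add, Prod.snd_add, h3, h4]
    exact T.graph.add_mem h1 h2
  smul_mem' := fun c p hp => by
    change ∀ᵐ t ∂wMeasure κ, _
    filter_upwards [hp, Lp.coeFn_smul c p.1, Lp.coeFn_smul c p.2] with t h1 h3 h4
    rw [Prod.smul_fst, Prod.smul_snd, h3, h4]
    exact T.graph.smul_mem c h1

/-- The operator `u ↦ T u(·)` in `L_{2,κ}(ℝ₊; H)`, with its maximal domain. -/
def pointwiseOp (κ : ℝ) (T : H →ₗ.[ℂ] H) : L2w κ H →ₗ.[ℂ] L2w κ H :=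
  (pointwiseGraph κ T).toLinearPMap

/-- The graph of `weakDeriv` is the defining relation: generalized derivatives are unique. -/
theorem weakDeriv_graph [CompleteSpace H] (κ : ℝ) (n : ℕ) :
    (weakDeriv κ H n).graph = weakDerivGraph κ H n := by
  refine Submodule.toLinearPMap_graph_eq _ ?_
  rintro ⟨u, g⟩ hp (rfl : u = 0)
  have h0 : ∀ ψ : ℝ → ℝ, ∫ t in Ioi 0, ψ t • (0 : L2w κ H) t = 0 := fun ψ => by
    rw [← integral_zero (α := ℝ) (G := H) (μ := volume.restrict (Ioi 0))]
    refine integral_congr_ae ?_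
    filter_upwards [(ae_wMeasure_iff κ).mp (Lp.coeFn_zero H 2 (wMeasure κ))] with t ht
    rw [ht, Pi.zero_apply, smul_zero]
  have hg : ∀ φ : ℝ → ℝ, IsTest φ → ∫ t in Ioi 0, φ t • g t = 0 := fun φ hφ => by
    have := hp φ hφ
    rw [h0] at this
    simpa using this.symm
  have hloc : LocallyIntegrableOn (fun t => g t) (Ioi (0 : ℝ)) := by
    rw [locallyIntegrableOn_iff isOpen_Ioi.isLocallyClosed]
    intro K hK hKc
    obtain ⟨ψ, hψ1, -, hψc, -⟩ := exists_continuous_one_zero_of_isCompact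
      (X := ℝ) hKc isClosed_empty (disjoint_empty K)
    have hi := integrable_smul_L2w ψ.continuous hψc g
    have hi' : IntegrableOn (fun t => ψ t • g t) K volume := IntegrableOn.mono_set hi hK
    exact hi'.congr_fun (fun t ht => by simp [hψ1 ht]) hKc.measurableSet
  have hae : ∀ᵐ t : ℝ, t ∈ Ioi (0 : ℝ) → g t = 0 :=
    isOpen_Ioi.ae_eq_zero_of_integral_contDiff_smul_eq_zero hloc fun φ hφ hc hs => by
      rw [← hg φ ⟨hφ, hc, hs⟩]
      refine (setIntegral_eq_integral_of_forall_compl_eq_zero fun t ht => ?_).symm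
      rw [image_eq_zero_of_notMem_tsupport fun h => ht (hs h), zero_smul]
  rw [← ae_restrict_iff' measurableSet_Ioi, ← ae_wMeasure_iff κ] at hae
  exact (Lp.eq_zero_iff_ae_eq_zero).mpr hae

/-- The graph of `pointwiseOp` is the defining relation. -/
theorem pointwiseOp_graph (κ : ℝ) (T : H →ₗ.[ℂ] H) :
    (pointwiseOp κ T).graph = pointwiseGraph κ T := by
  refine Submodule.toLinearPMap_graph_eq _ ?_
  rintro ⟨u, g⟩ hp (rfl : u = 0)
  refine (Lp.eq_zero_iff_ae_eq_zero).mpr ?_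
  filter_upwards [hp, Lp.coeFn_zero H 2 (wMeasure κ)] with t h1 h2
  rw [h2] at h1
  exact T.graph_fst_eq_zero_snd h1 rfl

/-! ### The spaces `W⁴_{2,κ}(ℝ₊; H)` -/

/-- `W⁴_{2,κ}(ℝ₊; H)`: all `u` with `d⁴u/dt⁴ ∈ L_{2,κ}` and `A⁴ u ∈ L_{2,κ}`. A separate type,
since its norm is not the one of `L_{2,κ}`. -/
def W4 (A : H →ₗ.[ℂ] H) (κ : ℝ) : Type _ :=
  ↥((weakDeriv κ H 4).domain ⊓ (pointwiseOp κ (opPow A 4)).domain)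

instance (A : H →ₗ.[ℂ] H) (κ : ℝ) : AddCommGroup (W4 A κ) :=
  inferInstanceAs (AddCommGroup
    ↥((weakDeriv κ H 4).domain ⊓ (pointwiseOp κ (opPow A 4)).domain))

instance (A : H →ₗ.[ℂ] H) (κ : ℝ) : Module ℂ (W4 A κ) :=
  inferInstanceAs (Module ℂ
    ↥((weakDeriv κ H 4).domain ⊓ (pointwiseOp κ (opPow A 4)).domain))

namespace W4

variable {A : H →ₗ.[ℂ] H} {κ : ℝ}

/-- The underlying element of `L_{2,κ}`. -/
def toL2 : W4 A κ →ₗ[ℂ] L2w κ H :=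
  Submodule.subtype ((weakDeriv κ H 4).domain ⊓ (pointwiseOp κ (opPow A 4)).domain)

/-- The generalized fourth derivative `d⁴u/dt⁴`. -/
def d4 : W4 A κ →ₗ[ℂ] L2w κ H :=
  (weakDeriv κ H 4).toFun ∘ₗ Submodule.inclusion inf_le_left

/-- The function `A⁴ u`. -/
def a4 : W4 A κ →ₗ[ℂ] L2w κ H :=
  (pointwiseOp κ (opPow A 4)).toFun ∘ₗ Submodule.inclusion inf_le_right

/-- `u ↦ (d⁴u/dt⁴, A⁴ u)`. -/
def pair : W4 A κ →ₗ[ℂ] WithLp 2 (L2w κ H × L2w κ H) :=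
  (WithLp.linearEquiv 2 ℂ (L2w κ H × L2w κ H)).symm.toLinearMap ∘ₗ d4.prod a4

/-- The norm `(‖d⁴u/dt⁴‖² + ‖A⁴ u‖²)^{1/2}`. -/
instance : SeminormedAddCommGroup (W4 A κ) :=
  SeminormedAddCommGroup.induced (W4 A κ) (WithLp 2 (L2w κ H × L2w κ H)) pair

instance : NormedSpace ℂ (W4 A κ) :=
  NormedSpace.induced ℂ (W4 A κ) (WithLp 2 (L2w κ H × L2w κ H)) pair

theorem norm_eq (u : W4 A κ) : ‖u‖ = Real.sqrt (‖d4 u‖ ^ 2 + ‖a4 u‖ ^ 2) :=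
  WithLp.prod_norm_eq_of_L2 (pair u)

end W4

/-- The subspace of `W⁴_{2,κ}(ℝ₊; H)` given by `u(0) = u'(0) = u''(0) = 0`: the values at `0` are
those of the representative of `u` that is twice continuously differentiable on `[0, ∞)`. -/
def W40 (A : H →ₗ.[ℂ] H) (κ : ℝ) : Submodule ℂ (W4 A κ) where
  carrier := {u | ∃ w : ℝ → H, w =ᵐ[wMeasure κ] W4.toL2 u ∧ ContDiffOn ℝ 2 w (Ici 0) ∧
    ∀ s : ℕ, s ≤ 2 → iteratedDerivWithin s w (Ici 0) 0 = 0}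
  zero_mem' := by
    refine ⟨0, ?_, contDiffOn_const, fun s _ => ?_⟩
    · rw [map_zero]
      exact (Lp.coeFn_zero H 2 (wMeasure κ)).symm
    · change iteratedDerivWithin s (fun _ => (0 : H)) (Ici 0) 0 = 0
      simp
  add_mem' := by
    rintro u v ⟨w, hw, hwc, hw0⟩ ⟨z, hz, hzc, hz0⟩
    refine ⟨w + z, ?_, hwc.add hzc, fun s hs => ?_⟩
    · rw [map_add]
      filter_upwards [hw, hz, Lp.coeFn_add (W4.toL2 u) (W4.toL2 v)] with t h1 h2 h3
      rw [h3, Pi.add_apply, Pi.add_apply, h1, h2]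
    · have hs' : (s : WithTop ℕ∞) ≤ 2 := mod_cast hs
      have h0 : (0 : ℝ) ∈ Ici (0 : ℝ) := self_mem_Ici
      rw [iteratedDerivWithin_add h0 (uniqueDiffOn_Ici 0) ((hwc.of_le hs') 0 h0)
        ((hzc.of_le hs') 0 h0), hw0 s hs, hz0 s hs, add_zero]
  smul_mem' := by
    rintro c u ⟨w, hw, hwc, hw0⟩
    refine ⟨c • w, ?_, hwc.const_smul c, fun s hs => ?_⟩
    · rw [map_smul]
      filter_upwards [hw, Lp.coeFn_smul c (W4.toL2 u)] with t h1 h3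
      rw [h3, Pi.smul_apply, Pi.smul_apply, h1]
    · have hs' : (s : WithTop ℕ∞) ≤ 2 := mod_cast hs
      have h0 : (0 : ℝ) ∈ Ici (0 : ℝ) := self_mem_Ici
      rw [iteratedDerivWithin_const_smul h0 (uniqueDiffOn_Ici 0) c ((hwc.of_le hs') 0 h0),
        hw0 s hs, smul_zero]

/-- The operator `(-d/dt + A)(d/dt + A)³` in `L_{2,κ}(ℝ₊; H)`, with its natural domain. -/
def P0 (A : H →ₗ.[ℂ] H) (κ : ℝ) : L2w κ H →ₗ.[ℂ] L2w κ H :=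
  opComp (-weakDeriv κ H 1 + pointwiseOp κ A) (opPow (weakDeriv κ H 1 + pointwiseOp κ A) 3)

end WeightedODE

end

/-!
Put `m = λ₀` and let `N` be `d/dt` with zero initial value, or `-d/dt`. Since `|κ| < 2m`, the
operator `N + m` has a bounded accretive inverse `V` on `L_{2,κ}`, which commutes with `B = A⁻¹`.
As `1 - m B ≥ 0`, accretivity gives `‖B x‖ ≤ ‖(B + (1 - m B) V) x‖`; hence the sum
`N + A = (N + m) + A - m` has a bounded inverse `R`, and `S = A R` is bounded too.

Let `R` belong to `d/dt` and `R'`, `S'` to `-d/dt`. Then `R³ R' f` solves `P₀ u = f` with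
`u(0) = u'(0) = u''(0) = 0`. Conversely, any `u ∈ W⁴_{2,κ}` satisfies `R'⁴ (A⁴ u) = S'⁴ u` and
`R'⁴ u⁽⁴⁾ = (S' - 1)⁴ u`, and a Bézout identity for `X⁴` and `(X - 1)⁴` yields `u = R'⁴ p` with
`p` bounded in terms of `A⁴ u` and `u⁽⁴⁾`. Since `(d/dt + A) R' = 2 S' - 1`, this gives
`P₀ u = (2 S' - 1)³ p`, and if the initial values of `u` vanish, then `R` cancels the factors
`d/dt + A` one at a time, so that `R³ R' P₀ u = u`.
-/

noncomputable section

namespace WeightedODE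

/-! ### Accretive operators and resolvents of commuting sums -/

section Accretive

variable {X : Type*} [NormedAddCommGroup X] [InnerProductSpace ℂ X]

/-- A bounded operator is accretive if its numerical range lies in the closed right half-plane.
The inverses of `d/dt` and `-d/dt` are of this kind; they are not self-adjoint, so the positivity
of the Loewner order does not apply. -/
def IsAccretive (V : X →L[ℂ] X) : Prop :=
  ∀ x, 0 ≤ (inner ℂ (V x) x).re

variable {B C V : X →L[ℂ] X}

theorem mul_right_cancel_of_denseRange {T Y W : X →L[ℂ] X} (hT : DenseRange T)
    (h : Y * T = W * T) : Y = W :=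
  ContinuousLinearMap.coeFn_injective <|
    hT.equalizer Y.continuous W.continuous <| funext fun x => DFunLike.congr_fun h x

/-- `R` inverts `A + N - m`, where `A` and `N` are the possibly unbounded operators with inverses
`B` and `V`, and `S = A R`. The two equations say that `R` is a right inverse, the implication that
it is a left inverse; unbounded operators do not occur in this formulation. -/
structure IsSumResolvent (B V : X →L[ℂ] X) (m : ℂ) (R S : X →L[ℂ] X) : Prop where
  mul_eq : B * S = R
  eq_mul : R = V * (1 - S + m • R)
  apply_eq : ∀ n a, V n = B a → R (n - m • V n + a) = V n

namespace IsSumResolvent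

variable {m : ℂ} {R S Z : X →L[ℂ] X}

theorem commute_left (h : IsSumResolvent B V m R S) (hB : Commute Z B) (hV : Commute Z V) :
    Commute Z R := by
  ext f
  have hVf : Z (R f) = V (Z (f - S f + m • R f)) := by
    conv_lhs => rw [h.eq_mul]
    exact DFunLike.congr_fun hV.eq _
  have hBf : Z (R f) = B (Z (S f)) := by
    conv_lhs => rw [← h.mul_eq]
    exact DFunLike.congr_fun hB.eq _
  have happly := h.apply_eq _ _ (hVf.symm.trans hBf)
  rw [← hVf] at happly
  calc Z (R f) = R (Z (f - S f + m • R f) - m • Z (R f) + Z (S f)) := happly.symm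
    _ = R (Z f) := by
      congr 1
      simp only [map_add, map_sub, map_smul]
      abel

theorem commute_right (h : IsSumResolvent B V m R S) (hinj : Function.Injective B)
    (hB : Commute Z B) (hV : Commute Z V) : Commute Z S := by
  ext f
  refine hinj ?_
  calc B (Z (S f)) = Z (B (S f)) := (DFunLike.congr_fun hB.eq (S f)).symm
    _ = Z (R f) := by rw [← h.mul_eq]; rfl
    _ = R (Z f) := DFunLike.congr_fun (h.commute_left hB hV).eq f
    _ = B (S (Z f)) := by rw [← h.mul_eq]; rfl

end IsSumResolvent

variable [CompleteSpace X]

theorem IsAccretive.adjoint (hV : IsAccretive V) : IsAccretive (ContinuousLinearMap.adjoint V) := by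
  intro x
  rw [ContinuousLinearMap.adjoint_inner_left, ← inner_conj_symm, Complex.conj_re]
  exact hV x

theorem IsAccretive.re_inner_nonneg_of_commute (hV : IsAccretive V) (hC : 0 ≤ C)
    (hCV : Commute C V) (x : X) : 0 ≤ (inner ℂ (V x) (C x)).re := by
  set s := CFC.sqrt C
  have hs : ∀ x y, inner ℂ (s x) y = inner ℂ x (s y) :=
    (ContinuousLinearMap.nonneg_iff_isPositive s |>.mp (CFC.sqrt_nonneg C)).isSymmetric
  have hsV : s (V x) = V (s x) := DFunLike.congr_fun (hCV.cfcₙ_nnreal NNReal.sqrt) x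
  have hC' : C x = s (s x) := DFunLike.congr_fun (CFC.sqrt_mul_sqrt_self C hC).symm x
  rw [hC', ← hs, hsV]
  exact hV (s x)

theorem IsAccretive.norm_apply_le (hV : IsAccretive V) (hB : 0 ≤ B) (hC : 0 ≤ C)
    (hBC : Commute B C) (hBV : Commute B V) (hCV : Commute C V) (x : X) :
    ‖B x‖ ≤ ‖(B + C * V) x‖ := by
  have hC' : inner ℂ (B x) (C (V x)) = inner ℂ ((C * B) x) (V x) :=
    ((ContinuousLinearMap.nonneg_iff_isPositive C).mp hC).isSymmetric (B x) (V x) |>.symm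
  have hcross : 0 ≤ (inner ℂ (B x) (C (V x))).re := by
    rw [hC', ← inner_conj_symm, Complex.conj_re]
    exact hV.re_inner_nonneg_of_commute (hBC.symm.mul_nonneg hC hB) (hCV.mul_left hBV) x
  have hexpand := norm_add_sq (𝕜 := ℂ) (B x) (C (V x))
  rw [RCLike.re_eq_complex_re] at hexpand
  refine (sq_le_sq₀ (norm_nonneg _) (norm_nonneg _)).mp ?_
  change ‖B x‖ ^ 2 ≤ ‖B x + C (V x)‖ ^ 2
  linarith [sq_nonneg ‖C (V x)‖]

theorem IsAccretive.denseRange_add_mul (hV : IsAccretive V) (hB : 0 ≤ B) (hC : 0 ≤ C)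
    (hBC : Commute B C) (hBV : Commute B V) (hCV : Commute C V) (hinj : Function.Injective B) :
    DenseRange (B + C * V) := by
  have hBs : star B = B := hB.isSelfAdjoint
  have hCs : star C = C := hC.isSelfAdjoint
  have hBV' : Commute B (star V) := by simpa only [hBs] using hBV.star_star
  have hCV' : Commute C (star V) := by simpa only [hCs] using hCV.star_star
  have hadj : ContinuousLinearMap.adjoint (B + C * V) = B + C * star V := by
    rw [← ContinuousLinearMap.star_eq_adjoint, star_add, star_mul, hBs, hCs, hCV'.eq]
  have hker : (ContinuousLinearMap.adjoint (B + C * V)).ker = ⊥ := by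
    refine LinearMap.ker_eq_bot'.mpr fun x hx => hinj ?_
    have hle := hV.adjoint.norm_apply_le hB hC hBC hBV' hCV' x
    rw [← ContinuousLinearMap.star_eq_adjoint, ← hadj] at hle
    rw [map_zero, ← norm_le_zero_iff]
    exact hle.trans_eq (norm_eq_zero.mpr hx)
  rw [← ContinuousLinearMap.orthogonal_range] at hker
  exact Submodule.dense_iff_topologicalClosure_eq_top.mpr
    (Submodule.topologicalClosure_eq_top_iff.mpr hker)

theorem IsAccretive.exists_mul_add_mul_eq (hV : IsAccretive V) (hB : 0 ≤ B) (hC : 0 ≤ C)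
    (hBC : Commute B C) (hBV : Commute B V) (hCV : Commute C V) (hinj : Function.Injective B) :
    ∃ Y : X →L[ℂ] X, Y * (B + C * V) = B ∧ (B + C * V) * Y = B ∧ V * Y = Y * V := by
  set T := B + C * V
  have hdense : DenseRange T := hV.denseRange_add_mul hB hC hBC hBV hCV hinj
  let Y : X →L[ℂ] X := B.toLinearMap.extendOfNorm T.toLinearMap
  have hYT : Y * T = B := ContinuousLinearMap.ext <|
    LinearMap.extendOfNorm_eq (f := B.toLinearMap) (e := T.toLinearMap) hdense
      ⟨1, fun x => (hV.norm_apply_le hB hC hBC hBV hCV x).trans_eq (one_mul _).symm⟩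
  have hBT : Commute B T := (Commute.refl B).add_right (hBC.mul_right hBV)
  have hVT : Commute V T := hBV.symm.add_right (hCV.symm.mul_right (Commute.refl V))
  refine ⟨Y, hYT, mul_right_cancel_of_denseRange hdense ?_,
    mul_right_cancel_of_denseRange hdense ?_⟩
  · rw [mul_assoc, hYT, hBT.eq]
  · rw [mul_assoc, hYT, mul_assoc, hVT.eq, ← mul_assoc, hYT, hBV.eq]

theorem IsAccretive.exists_isSumResolvent (hV : IsAccretive V) {m : ℂ} (hB : 0 ≤ B)
    (hC : 0 ≤ 1 - m • B) (hBV : Commute B V) (hinj : Function.Injective B) :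
    ∃ R S : X →L[ℂ] X, IsSumResolvent B V m R S := by
  have hBC : Commute B (1 - m • B) :=
    (Commute.one_right B).sub_right ((Commute.refl B).smul_right m)
  have hCV : Commute (1 - m • B) V := (Commute.one_left V).sub_left (hBV.smul_left m)
  obtain ⟨Y, hYT, hTY, hVY⟩ := hV.exists_mul_add_mul_eq hB hC hBC hBV hCV hinj
  refine ⟨V * Y, 1 - Y + m • (V * Y), ⟨?_, ?_, fun n a hna => ?_⟩⟩
  · calc B * (1 - Y + m • (V * Y)) =
          (B + (1 - m • B) * V) * Y - B * Y + m • (B * (V * Y)) := by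
          rw [hTY, mul_add, mul_sub, mul_one, mul_smul_comm]
      _ = V * Y := by
          simp only [add_mul, sub_mul, one_mul, smul_mul_assoc, mul_assoc]
          abel
  · congr 1
    abel
  · have hBVa : B (V a) = V (B a) := DFunLike.congr_fun hBV.eq a
    have hTa : (B + (1 - m • B) * V) a = V (n - m • V n + a) := by
      calc (B + (1 - m • B) * V) a = B a + (V a - m • B (V a)) := rfl
        _ = V (n - m • V n + a) := by
          rw [hBVa, ← hna, map_add, map_sub, map_smul]
          abel
    calc (V * Y) (n - m • V n + a) = Y ((B + (1 - m • B) * V) a) := by rw [hVY, hTa]; rfl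
      _ = V n := (DFunLike.congr_fun hYT a).trans hna.symm

end Accretive

/-! ### Algebra of the resolvents -/

section ResolventAlgebra

variable {X : Type*} [NormedAddCommGroup X] [InnerProductSpace ℂ X] {B V R S : X →L[ℂ] X} {m : ℂ}

theorem exists_eq_pow_apply (hRS : Commute R S) (n : ℕ) :
    ∃ C D : X →L[ℂ] X, ∀ u a g, (R ^ n) a = (S ^ n) u → (R ^ n) g = ((S - 1 : X →L[ℂ] X) ^ n) u →
      u = (R ^ n) (C a + D g) := by
  obtain ⟨p, q, hpq⟩ : IsCoprime ((Polynomial.X : Polynomial ℂ) ^ n) ((Polynomial.X - 1) ^ n) :=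
    IsCoprime.pow ⟨1, -1, by ring⟩
  have hbezout : Polynomial.aeval S p * S ^ n + Polynomial.aeval S q * (S - 1) ^ n = 1 := by
    simpa using congrArg (Polynomial.aeval S) hpq
  have hcomm : ∀ r : Polynomial ℂ, Commute (Polynomial.aeval S r) (R ^ n) := fun r =>
    (Algebra.commute_of_mem_adjoin_singleton_of_commute (R := ℂ)
      (Polynomial.aeval_mem_adjoin_singleton ℂ S) hRS).symm.pow_right n
  refine ⟨Polynomial.aeval S p, Polynomial.aeval S q, fun u a g ha hg => ?_⟩
  calc u = Polynomial.aeval S p ((S ^ n) u) +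
        Polynomial.aeval S q (((S - 1 : X →L[ℂ] X) ^ n) u) := (DFunLike.congr_fun hbezout u).symm
    _ = (R ^ n) (Polynomial.aeval S p a + Polynomial.aeval S q g) := by
      rw [← ha, ← hg, map_add]
      exact congrArg₂ (· + ·) (DFunLike.congr_fun (hcomm p).eq a)
        (DFunLike.congr_fun (hcomm q).eq g)

namespace IsSumResolvent

theorem commute_self (h : IsSumResolvent B V m R S) (hinj : Function.Injective B)
    (hBV : Commute B V) : Commute R S :=
  h.commute_right hinj (h.commute_left (Commute.refl B) hBV).symm
    (h.commute_left hBV.symm (Commute.refl V)).symm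

theorem pow_eq_pow_mul (h : IsSumResolvent B V m R S) (hinj : Function.Injective B)
    (hBV : Commute B V) (n : ℕ) : R ^ n = S ^ n * B ^ n := by
  have hBS := h.commute_right hinj (Commute.refl B) hBV
  rw [← hBS.symm.mul_pow, hBS.symm.eq, h.mul_eq]

theorem pow_apply_eq_of_pow_apply_eq (h : IsSumResolvent B V m R S) (hinj : Function.Injective B)
    (hBV : Commute B V) {n : ℕ} {u g : X}
    (hug : (V ^ n) g = ((m • V - 1 : X →L[ℂ] X) ^ n) u) :
    (R ^ n) g = ((S - 1 : X →L[ℂ] X) ^ n) u := by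
  set K : X →L[ℂ] X := 1 - S + m • R
  have hVK : Commute V K :=
    ((Commute.one_right V).sub_right (h.commute_right hinj hBV.symm (Commute.refl V))).add_right
      ((h.commute_left hBV.symm (Commute.refl V)).smul_right m)
  have hVK' : Commute (m • V - 1) K := (hVK.smul_left m).sub_left (Commute.one_left K)
  have hS : S - 1 = K * (m • V - 1) := by
    rw [← hVK'.eq, sub_mul, smul_mul_assoc, ← h.eq_mul, one_mul]
    simp only [K]
    abel
  have hR : R = K * V := h.eq_mul.trans hVK.eq
  rw [hR, hS, hVK.symm.mul_pow, hVK'.symm.mul_pow, mul_apply_eq_comp, hug,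
    mul_apply_eq_comp]

theorem apply_add (h : IsSumResolvent B V m R S) {y g a : X} (hg : V (g + m • y) = y)
    (ha : y = B a) : R (g + a) = y := by
  have happly := h.apply_eq _ _ (hg.trans ha)
  rwa [hg, add_sub_cancel_right] at happly

end IsSumResolvent

/-- The `k` for which `R k` vanishes at `0`, where `R` is the inverse of `-d/dt + A`, `S = A R` and
`V` is the inverse of `d/dt + m` with zero initial value: those for which `V` recovers `R k` from
`(d/dt + m) R k`. -/
def zeroInitial (V R S : X →L[ℂ] X) (m : ℂ) : Submodule ℂ X :=
  (V * (S - 1 + m • R) - R).ker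

theorem mem_zeroInitial_iff {k : X} :
    k ∈ zeroInitial V R S m ↔ V (S k - k + m • R k) = R k :=
  sub_eq_zero (a := V (S k - k + m • R k))

theorem mem_zeroInitial_of_apply_mem (hinj : Function.Injective B) (hBV : Commute B V)
    (hBR : Commute B R) (hBS : Commute B S) {k : X} (hk : B k ∈ zeroInitial V R S m) :
    k ∈ zeroInitial V R S m := by
  have hcomm : Commute B (V * (S - 1 + m • R) - R) :=
    (hBV.mul_right ((hBS.sub_right (Commute.one_right B)).add_right (hBR.smul_right m))).sub_right
      hBR
  exact hinj ((DFunLike.congr_fun hcomm.eq k).trans (hk.trans (map_zero B).symm))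

section Pair

variable {V' R' S' : X →L[ℂ] X}

theorem IsSumResolvent.apply_of_mem_zeroInitial (h : IsSumResolvent B V m R S) (hB : B * S' = R')
    {k : X} (hk : k ∈ zeroInitial V R' S' m) : R ((2 * S' - 1 : X →L[ℂ] X) k) = R' k := by
  have hk' : (2 * S' - 1 : X →L[ℂ] X) k = S' k - k + S' k := by
    rw [two_mul]
    exact (sub_add_eq_add_sub _ _ _).symm
  rw [hk']
  exact h.apply_add (mem_zeroInitial_iff.mp hk) (DFunLike.congr_fun hB k).symm

theorem mem_zeroInitial_mul (hinj : Function.Injective B) (hBV : Commute B V) (hB : B * S' = R')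
    (hBR : Commute B R') (hBS : Commute B S') {f : X}
    (h₀ : (R' ^ 3) f ∈ zeroInitial V R' S' m)
    (h₁ : (R' ^ 2 * (S' - 1) : X →L[ℂ] X) f ∈ zeroInitial V R' S' m)
    (h₂ : (R' * (S' - 1) ^ 2 : X →L[ℂ] X) f ∈ zeroInitial V R' S' m) :
    (R' ^ 2 * (2 * S' - 1) : X →L[ℂ] X) f ∈ zeroInitial V R' S' m ∧
      (R' * (2 * S' - 1) ^ 2 : X →L[ℂ] X) f ∈ zeroInitial V R' S' m := by
  set K := zeroInitial V R' S' m
  have hdiv : ∀ Q Q' : X →L[ℂ] X, B * Q = Q' → Q' f ∈ K → Q f ∈ K := by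
    rintro Q _ rfl
    exact mem_zeroInitial_of_apply_mem hinj hBV hBR hBS
  have hs₀ : (R' ^ 2 * S') f ∈ K := hdiv _ _ (by
    rw [← mul_assoc, (hBR.pow_right 2).eq, mul_assoc, hB, ← pow_succ]) h₀
  have hs₁ : (R' * S' * (S' - 1) : X →L[ℂ] X) f ∈ K := hdiv _ _ (by
    rw [← mul_assoc, ← mul_assoc, hBR.eq, mul_assoc R', hB, ← pow_two]) h₁
  have hs₂ : (R' * S' ^ 2) f ∈ K := hdiv _ _ (by
    rw [pow_two, ← mul_assoc, hBR.eq, mul_assoc R', ← mul_assoc B, hB, ← mul_assoc,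
      ← pow_two]) hs₀
  have hz₁ : R' ^ 2 * (2 * S' - 1) = R' ^ 2 * (S' - 1) + R' ^ 2 * S' := by noncomm_ring
  have hz₂ : R' * (2 * S' - 1) ^ 2 = R' * (S' - 1) ^ 2 +
      (R' * S' * (S' - 1) + R' * S' * (S' - 1)) + R' * S' ^ 2 := by noncomm_ring
  rw [hz₁, hz₂]
  exact ⟨K.add_mem h₁ hs₀, K.add_mem (K.add_mem h₂ (K.add_mem hs₁ hs₁)) hs₂⟩

/-- The three memberships say that `u = R'⁴ f`, `u'` and `u''` vanish at `0`. -/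
theorem IsSumResolvent.pow_three_apply_eq (h : IsSumResolvent B V m R S)
    (hinj : Function.Injective B) (hBV : Commute B V) (hB : B * S' = R') (hBR : Commute B R')
    (hBS : Commute B S') (hRS : Commute R' S') {f : X}
    (h₀ : (R' ^ 3) f ∈ zeroInitial V R' S' m)
    (h₁ : (R' ^ 2 * (S' - 1) : X →L[ℂ] X) f ∈ zeroInitial V R' S' m)
    (h₂ : (R' * (S' - 1) ^ 2 : X →L[ℂ] X) f ∈ zeroInitial V R' S' m) :
    (R ^ 3) (R' (((2 * S' - 1 : X →L[ℂ] X) ^ 3) f)) = (R' ^ 4) f := by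
  obtain ⟨hz₁, hz₂⟩ := mem_zeroInitial_mul hinj hBV hB hBR hBS h₀ h₁ h₂
  set Z : X →L[ℂ] X := 2 * S' - 1
  have hRZ : Commute R' Z :=
    ((Commute.ofNat_right R' 2).mul_right hRS).sub_right (Commute.one_right R')
  have hstep : ∀ i j, (R' ^ i * Z ^ j) f ∈ zeroInitial V R' S' m →
      R ((R' ^ i * Z ^ (j + 1)) f) = (R' ^ (i + 1) * Z ^ j) f := fun i j hk => by
    rw [pow_succ', ← mul_assoc, (hRZ.pow_left i).eq, mul_assoc, pow_succ' R', mul_assoc]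
    exact h.apply_of_mem_zeroInitial hB hk
  calc (R ^ 3) (R' ((Z ^ 3) f)) = R (R (R ((R' ^ 1 * Z ^ (2 + 1)) f))) := rfl
    _ = R (R ((R' ^ 2 * Z ^ (1 + 1)) f)) := by rw [hstep 1 2 (by rwa [pow_one])]
    _ = R ((R' ^ 3 * Z ^ (0 + 1)) f) := by rw [hstep 2 1 (by rwa [pow_one])]
    _ = (R' ^ 4) f := hstep 3 0 h₀

end Pair

end ResolventAlgebra

/-! ### The bounded inverse of a strictly positive operator -/

section Inverse

variable {H : Type*} [NormedAddCommGroup H] [InnerProductSpace ℂ H]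
  {A : H →ₗ.[ℂ] H} {m : ℝ}

theorem mul_norm_le_norm_apply
    (hA_ge : ∀ x : A.domain, m * ‖(x : H)‖ ^ 2 ≤ (inner ℂ (A x) (x : H)).re) (x : A.domain) :
    m * ‖(x : H)‖ ≤ ‖A x‖ := by
  rcases (norm_nonneg (x : H)).eq_or_lt with hx | hx
  · rw [← hx, mul_zero]
    exact norm_nonneg _
  · refine le_of_mul_le_mul_right ?_ hx
    calc m * ‖(x : H)‖ * ‖(x : H)‖ = m * ‖(x : H)‖ ^ 2 := by ring
      _ ≤ (inner ℂ (A x) (x : H)).re := hA_ge x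
      _ ≤ ‖A x‖ * ‖(x : H)‖ := (Complex.re_le_norm _).trans (norm_inner_le_norm _ _)

variable {B : H →L[ℂ] H}

theorem exists_apply_eq_of_mem_graph_iff (hB : ∀ x y, (x, y) ∈ A.graph ↔ x = B y) (y : H) :
    ∃ x : A.domain, (x : H) = B y ∧ A x = y :=
  (LinearPMap.mem_graph_iff A).mp ((hB (B y) y).mpr rfl)

theorem injective_of_mem_graph_iff (hB : ∀ x y, (x, y) ∈ A.graph ↔ x = B y) :
    Function.Injective B := fun x y hxy =>
  A.mem_graph_snd_inj ((hB (B x) x).mpr rfl) ((hB (B y) y).mpr rfl) hxy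

variable [CompleteSpace H]

theorem isClosed_range_of_mul_norm_le (hA : A.IsClosed) (hm : 0 < m)
    (hle : ∀ x : A.domain, m * ‖(x : H)‖ ≤ ‖A x‖) : IsClosed (range A) := by
  have hgraph : IsClosed (A.graph : Set (H × H)) := hA
  have : CompleteSpace A.graph := hgraph.completeSpace_coe
  let p : A.graph →L[ℂ] H := (ContinuousLinearMap.snd ℂ H H) ∘L A.graph.subtypeL
  have hanti : AntilipschitzWith (Real.toNNReal (max 1 m⁻¹)) p := by
    refine ContinuousLinearMap.antilipschitz_of_bound _ ?_
    rintro ⟨⟨_, _⟩, hxy⟩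
    obtain ⟨x, rfl, rfl⟩ := (LinearPMap.mem_graph_iff A).mp hxy
    rw [Real.coe_toNNReal _ (zero_le_one.trans (le_max_left 1 m⁻¹))]
    refine max_le ?_ (le_mul_of_one_le_left (norm_nonneg _) (le_max_left 1 m⁻¹))
    calc ‖(x : H)‖ = m⁻¹ * (m * ‖(x : H)‖) := by field_simp
      _ ≤ m⁻¹ * ‖A x‖ := by gcongr; exact hle x
      _ ≤ max 1 m⁻¹ * ‖A x‖ := by gcongr; exact le_max_right _ _
  have hrange : range A = range p := by
    ext y
    constructor
    · rintro ⟨x, rfl⟩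
      exact ⟨⟨_, A.mem_graph x⟩, rfl⟩
    · rintro ⟨⟨⟨_, _⟩, hxy⟩, rfl⟩
      obtain ⟨x, rfl, rfl⟩ := (LinearPMap.mem_graph_iff A).mp hxy
      exact ⟨x, rfl⟩
  rw [hrange]
  exact hanti.isClosed_range p.uniformContinuous

theorem inner_apply_eq_of_isSelfAdjoint (hA : IsSelfAdjoint A) (x y : A.domain) :
    inner ℂ (A x) (y : H) = inner ℂ (x : H) (A y) := by
  have hformal := LinearPMap.adjoint_isFormalAdjoint hA.dense_domain
  rw [LinearPMap.isSelfAdjoint_def.mp hA] at hformal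
  exact hformal x y

theorem mem_graph_zero_of_forall_inner_eq_zero (hA : IsSelfAdjoint A) {z : H}
    (hz : ∀ x : A.domain, inner ℂ (A x) z = 0) : (z, (0 : H)) ∈ A.graph := by
  rw [← LinearPMap.isSelfAdjoint_def.mp hA,
    LinearPMap.adjoint_graph_eq_graph_adjoint hA.dense_domain, Submodule.mem_adjoint_iff]
  intro a b hab
  obtain ⟨x, rfl, rfl⟩ := (LinearPMap.mem_graph_iff A).mp hab
  simp [hz x]

theorem surjective_of_mul_norm_le (hA : IsSelfAdjoint A) (hm : 0 < m)
    (hle : ∀ x : A.domain, m * ‖(x : H)‖ ≤ ‖A x‖) : Function.Surjective A := by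
  have horth : (LinearMap.range A.toFun)ᗮ = ⊥ := by
    refine (Submodule.eq_bot_iff _).mpr fun z hz => ?_
    obtain ⟨x, rfl, hx⟩ := (LinearPMap.mem_graph_iff A).mp <|
      mem_graph_zero_of_forall_inner_eq_zero hA fun x => hz (A x) ⟨x, rfl⟩
    have hle' := hle x
    rw [hx, norm_zero] at hle'
    exact norm_le_zero_iff.mp (nonpos_of_mul_nonpos_right hle' hm)
  have hdense : Dense (range A) := Submodule.dense_iff_topologicalClosure_eq_top.mpr
    (Submodule.topologicalClosure_eq_top_iff.mpr horth)
  have hclosed := isClosed_range_of_mul_norm_le hA.isClosed hm hle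
  exact range_eq_univ.mp (hclosed.closure_eq.symm.trans hdense.closure_eq)

theorem exists_bounded_inverse (hA : IsSelfAdjoint A) (hm : 0 < m)
    (hle : ∀ x : A.domain, m * ‖(x : H)‖ ≤ ‖A x‖) :
    ∃ B : H →L[ℂ] H, ∀ x y, (x, y) ∈ A.graph ↔ x = B y := by
  have hinj : Function.Injective A.toFun :=
    (injective_iff_map_eq_zero A.toFun).mpr fun x (hx : A x = 0) => by
      have hle' := hle x
      rw [hx, norm_zero] at hle'
      exact Subtype.ext (norm_le_zero_iff.mp (nonpos_of_mul_nonpos_right hle' hm))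
  let e := LinearEquiv.ofBijective A.toFun ⟨hinj, surjective_of_mul_norm_le hA hm hle⟩
  have he : ∀ y, A (e.symm y) = y := e.apply_symm_apply
  let B : H →L[ℂ] H := (A.domain.subtype ∘ₗ e.symm.toLinearMap).mkContinuous m⁻¹ fun y => by
    rw [le_inv_mul_iff₀ hm]
    exact (hle (e.symm y)).trans_eq (congrArg norm (he y))
  refine ⟨B, fun x y => ⟨fun hxy => ?_, ?_⟩⟩
  · obtain ⟨z, rfl, rfl⟩ := (LinearPMap.mem_graph_iff A).mp hxy
    exact congrArg Subtype.val (e.symm_apply_apply z).symm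
  · rintro rfl
    exact (LinearPMap.mem_graph_iff A).mpr ⟨e.symm y, rfl, he y⟩

theorem nonneg_of_mem_graph_iff (hA : IsSelfAdjoint A) (hm : 0 ≤ m)
    (hA_ge : ∀ x : A.domain, m * ‖(x : H)‖ ^ 2 ≤ (inner ℂ (A x) (x : H)).re)
    (hB : ∀ x y, (x, y) ∈ A.graph ↔ x = B y) : 0 ≤ B := by
  rw [ContinuousLinearMap.nonneg_iff_isPositive]
  refine ⟨fun x y => ?_, fun y => ?_⟩
  · obtain ⟨x', hx', rfl⟩ := exists_apply_eq_of_mem_graph_iff hB x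
    obtain ⟨y', hy', rfl⟩ := exists_apply_eq_of_mem_graph_iff hB y
    exact hx' ▸ hy' ▸ (inner_apply_eq_of_isSelfAdjoint hA x' y').symm
  · obtain ⟨y', hy', rfl⟩ := exists_apply_eq_of_mem_graph_iff hB y
    have hpos : 0 ≤ (inner ℂ (A y') (y' : H)).re := le_trans (by positivity) (hA_ge y')
    rw [inner_apply_eq_of_isSelfAdjoint hA, hy'] at hpos
    exact hpos

theorem one_sub_smul_nonneg_of_mem_graph_iff (hA : IsSelfAdjoint A) (hm : 0 < m)
    (hA_ge : ∀ x : A.domain, m * ‖(x : H)‖ ^ 2 ≤ (inner ℂ (A x) (x : H)).re)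
    (hB : ∀ x y, (x, y) ∈ A.graph ↔ x = B y) : 0 ≤ 1 - (m : ℂ) • B := by
  have hnonneg : 0 ≤ (m : ℂ) • B := by
    have hB0 := nonneg_of_mem_graph_iff hA hm.le hA_ge hB
    rw [ContinuousLinearMap.nonneg_iff_isPositive] at hB0 ⊢
    exact hB0.smul_of_nonneg (by exact_mod_cast hm.le)
  have hnorm : ‖(m : ℂ) • B‖ ≤ 1 := ContinuousLinearMap.opNorm_le_bound _ zero_le_one fun y => by
    obtain ⟨x, hx, rfl⟩ := exists_apply_eq_of_mem_graph_iff hB y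
    rw [smul_apply, norm_smul, Complex.norm_real, Real.norm_of_nonneg hm.le, one_mul, ← hx]
    exact mul_norm_le_norm_apply hA_ge x
  exact sub_nonneg.mpr ((CStarAlgebra.norm_le_one_iff_of_nonneg _).mp hnorm)

end Inverse

/-! ### Primitives of locally integrable functions -/

section Primitive

variable {E F G : Type*} [NormedAddCommGroup E] {f g : ℝ → E}

/-- Integrability on all intervals `(0, T]`, that is, local integrability on the closed half-line
`[0, ∞)`. Values on `(-∞, 0]` play no role. -/
def LocInt (g : ℝ → E) : Prop :=
  ∀ T : ℝ, IntegrableOn g (Ioc 0 T)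

theorem LocInt.add (hf : LocInt f) (hg : LocInt g) : LocInt (fun t => f t + g t) :=
  fun T => (hf T).add (hg T)

theorem LocInt.integrableOn_Icc (hg : LocInt g) (T : ℝ) : IntegrableOn g (Icc 0 T) :=
  (integrableOn_Icc_iff_integrableOn_Ioc (by simp)).mpr (hg T)

theorem locInt_of_continuous (hg : Continuous g) : LocInt g :=
  fun _ => hg.integrableOn_Ioc

variable [NormedSpace ℝ E] [NormedAddCommGroup F] [NormedSpace ℝ F]
  [NormedAddCommGroup G] [NormedSpace ℝ G]

theorem LocInt.smul {φ : ℝ → ℝ} (hg : LocInt g) (hφ : Continuous φ) :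
    LocInt (fun t => φ t • g t) :=
  fun T => ((hg.integrableOn_Icc T).continuousOn_smul hφ.continuousOn isCompact_Icc).mono_set
    Ioc_subset_Icc_self

/-- The primitive of `g` on the half-line that vanishes at `0`; it is zero on `(-∞, 0]`. -/
def prim (g : ℝ → E) (t : ℝ) : E :=
  ∫ s in Ioc 0 t, g s

theorem prim_zero (g : ℝ → E) : prim g 0 = 0 := by
  simp [prim]

theorem prim_congr_ae (h : f =ᵐ[volume.restrict (Ioi 0)] g) : prim f = prim g :=
  funext fun _ =>
    integral_congr_ae (ae_mono (Measure.restrict_mono Ioc_subset_Ioi_self le_rfl) h)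

theorem prim_add (hf : LocInt f) (hg : LocInt g) (t : ℝ) :
    prim (fun t => f t + g t) t = prim f t + prim g t :=
  integral_add (hf t) (hg t)

theorem prim_const_smul (c : ℝ) (g : ℝ → E) (t : ℝ) : prim (fun t => c • g t) t = c • prim g t :=
  integral_smul c g

theorem prim_eq_intervalIntegral (g : ℝ → E) {t : ℝ} (ht : 0 ≤ t) :
    prim g t = ∫ s in (0 : ℝ)..t, g s :=
  (intervalIntegral.integral_of_le ht).symm

theorem prim_eq_intervalIntegral_indicator (g : ℝ → E) (t : ℝ) :
    prim g t = ∫ s in (0 : ℝ)..t, (Ioi 0).indicator g s := by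
  rcases le_total 0 t with ht | ht
  · rw [intervalIntegral.integral_of_le ht, setIntegral_indicator measurableSet_Ioi,
      inter_eq_left.mpr Ioc_subset_Ioi_self, prim]
  · rw [intervalIntegral.integral_of_ge ht, setIntegral_indicator measurableSet_Ioi,
      Ioc_inter_Ioi, prim, Ioc_eq_empty ht.not_gt, Ioc_eq_empty (by simp)]
    simp

theorem continuous_prim (hg : LocInt g) : Continuous (prim g) := by
  rw [funext (prim_eq_intervalIntegral_indicator g)]
  refine intervalIntegral.continuous_primitive (fun a b => ?_) 0
  rw [intervalIntegrable_iff, integrableOn_indicator_iff measurableSet_Ioi]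
  exact (hg (max a b)).mono_set fun s hs => ⟨hs.1, hs.2.2⟩

theorem prim_deriv {φ : ℝ → ℝ} (hφ : ContDiff ℝ 1 φ) {t : ℝ} (ht : 0 ≤ t) :
    prim (deriv φ) t = φ t - φ 0 := by
  rw [prim_eq_intervalIntegral _ ht]
  exact intervalIntegral.integral_deriv_eq_sub (fun x _ => hφ.differentiable (by simp) x)
    ((hφ.continuous_deriv le_rfl).intervalIntegrable _ _)

theorem setIntegral_indicator_Iic_eq_prim (g : ℝ → E) {t T : ℝ} (ht : t ≤ T) :
    ∫ s in Ioc 0 T, (Iic t).indicator g s = prim g t := by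
  rw [setIntegral_indicator measurableSet_Iic, Ioc_inter_Iic, min_eq_right ht, prim]

theorem setIntegral_indicator_Iio_eq_prim (g : ℝ → E) {t T : ℝ} (ht : t ≤ T) :
    ∫ s in Ioc 0 T, (Iio t).indicator g s = prim g t := by
  rw [← setIntegral_indicator_Iic_eq_prim g ht]
  refine integral_congr_ae (ae_restrict_of_ae ?_)
  exact indicator_ae_eq_of_ae_eq_set Iio_ae_eq_Iic

variable [CompleteSpace E] [CompleteSpace F]

theorem prim_clm (L : E →L[ℝ] F) (hg : LocInt g) (t : ℝ) :
    prim (fun s => L (g s)) t = L (prim g t) :=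
  L.integral_comp_comm (hg t)

theorem prim_bilin [CompleteSpace G] (L : E →L[ℝ] F →L[ℝ] G) {g : ℝ → F} (hf : LocInt f)
    (hg : LocInt g) (T : ℝ) :
    L (prim f T) (prim g T) = prim (fun t => L (f t) (prim g t) + L (prim f t) (g t)) T := by
  set ν := (volume : Measure ℝ).restrict (Ioc 0 T)
  set Φ : ℝ × ℝ → G := fun z => L (f z.1) (g z.2)
  set U : Set (ℝ × ℝ) := {z | z.2 ≤ z.1}
  have hΦ : Integrable Φ (ν.prod ν) :=
    Integrable.op_fst_snd (op := fun x y => L x y) (by fun_prop) ⟨‖L‖, L.le_opNorm₂⟩ (hf T) (hg T)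
  have hU : MeasurableSet U := measurableSet_le measurable_snd measurable_fst
  have hlower : ∀ᵐ t ∂ν, ∫ s, U.indicator Φ (t, s) ∂ν = L (f t) (prim g t) := by
    filter_upwards [ae_restrict_mem measurableSet_Ioc] with t ht
    calc ∫ s, U.indicator Φ (t, s) ∂ν = ∫ s, (Iic t).indicator (fun s => L (f t) (g s)) s ∂ν := rfl
      _ = prim (fun s => L (f t) (g s)) t := setIntegral_indicator_Iic_eq_prim _ ht.2
      _ = L (f t) (prim g t) := prim_clm _ hg t
  have hupper : ∀ᵐ s ∂ν, ∫ t, Uᶜ.indicator Φ (t, s) ∂ν = L (prim f s) (g s) := by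
    filter_upwards [ae_restrict_mem measurableSet_Ioc] with s hs
    calc ∫ t, Uᶜ.indicator Φ (t, s) ∂ν = ∫ t, (Iio s).indicator (fun t => L (f t) (g s)) t ∂ν := by
          simp only [U, Φ, indicator_apply, mem_compl_iff, mem_ofPred_eq, not_le, mem_Iio]
      _ = prim (fun t => L.flip (g s) (f t)) s := setIntegral_indicator_Iio_eq_prim _ hs.2
      _ = L (prim f s) (g s) := prim_clm _ hf s
  symm
  calc prim (fun t => L (f t) (prim g t) + L (prim f t) (g t)) T
      = (∫ t, L (f t) (prim g t) ∂ν) + ∫ t, L (prim f t) (g t) ∂ν :=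
        integral_add ((hΦ.indicator hU).integral_prod_left.congr hlower)
          ((hΦ.indicator hU.compl).integral_prod_right.congr hupper)
    _ = (∫ z, U.indicator Φ z ∂ν.prod ν) + ∫ z, Uᶜ.indicator Φ z ∂ν.prod ν := by
        rw [integral_prod _ (hΦ.indicator hU), integral_prod_symm _ (hΦ.indicator hU.compl),
          integral_congr_ae hlower, integral_congr_ae hupper]
    _ = ∫ z, Φ z ∂ν.prod ν := by
        rw [← integral_add (hΦ.indicator hU) (hΦ.indicator hU.compl)]
        simp_rw [indicator_self_add_compl_apply]
    _ = L (prim f T) (prim g T) := integral_prod_bilin (𝕜 := ℝ) L (hf T) (hg T)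

theorem smul_prim {φ : ℝ → ℝ} (hφ : ContDiff ℝ 1 φ) (hg : LocInt g) {t : ℝ} (ht : 0 ≤ t) :
    φ t • prim g t = prim (fun s => deriv φ s • prim g s + φ s • g s) t := by
  have hd : LocInt (deriv φ) := locInt_of_continuous (hφ.continuous_deriv le_rfl)
  have hprod : LocInt fun s => deriv φ s • prim g s + prim (deriv φ) s • g s :=
    (locInt_of_continuous ((hφ.continuous_deriv le_rfl).smul (continuous_prim hg))).add
      (hg.smul (continuous_prim hd))
  calc φ t • prim g t = prim (deriv φ) t • prim g t + φ 0 • prim g t := by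
        rw [prim_deriv hφ ht, sub_smul, sub_add_cancel]
    _ = prim (fun s => deriv φ s • prim g s + prim (deriv φ) s • g s) t
        + prim (fun s => φ 0 • g s) t := by
        rw [prim_const_smul]
        exact congrArg (· + _) (prim_bilin (ContinuousLinearMap.lsmul ℝ ℝ) hd hg t)
    _ = prim (fun s => deriv φ s • prim g s + φ s • g s) t := by
        rw [← prim_add hprod (hg.smul continuous_const)]
        refine setIntegral_congr_fun measurableSet_Ioc fun s hs => ?_
        simp only [prim_deriv hφ hs.1.le, sub_smul]
        abel

end Primitive

section PrimitiveInner

variable {E : Type*} [NormedAddCommGroup E] [InnerProductSpace ℝ E] {f g : ℝ → E}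

theorem LocInt.inner_of_continuous (hf : LocInt f) (hg : Continuous g) :
    LocInt fun t => inner ℝ (f t) (g t) := fun T => by
  obtain ⟨C, hC⟩ := isCompact_Icc.exists_bound_of_continuousOn (s := Icc 0 T) hg.continuousOn
  refine Integrable.mono' (g := fun t => ‖f t‖ * C) ((hf T).norm.mul_const C)
    ((hf T).1.inner hg.aestronglyMeasurable) ?_
  filter_upwards [ae_restrict_mem measurableSet_Ioc] with t ht
  exact (norm_inner_le_norm _ _).trans
    (mul_le_mul_of_nonneg_left (hC t (Ioc_subset_Icc_self ht)) (norm_nonneg _))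

theorem norm_sq_prim [CompleteSpace E] (hg : LocInt g) (T : ℝ) :
    ‖prim g T‖ ^ 2 = prim (fun t => 2 * inner ℝ (g t) (prim g t)) T := by
  calc ‖prim g T‖ ^ 2 = inner ℝ (prim g T) (prim g T) := (real_inner_self_eq_norm_sq _).symm
    _ = prim (fun t => inner ℝ (g t) (prim g t) + inner ℝ (prim g t) (g t)) T :=
      prim_bilin (isBoundedBilinearMap_inner (𝕜 := ℝ)).toContinuousLinearMap hg hg T
    _ = prim (fun t => 2 * inner ℝ (g t) (prim g t)) T := by
      simp only [real_inner_comm (g _), two_mul]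

end PrimitiveInner

/-! ### The weighted space `L_{2,κ}` and operators acting pointwise -/

section Weighted

attribute [local instance] InnerProductSpace.complexToReal

variable {E H : Type*} [NormedAddCommGroup E] [NormedSpace ℝ E] [NormedAddCommGroup H] {κ : ℝ}

theorem integral_wMeasure (κ : ℝ) (F : ℝ → E) :
    ∫ t, F t ∂wMeasure κ = ∫ t in Ioi 0, Real.exp (-κ * t) • F t := by
  rw [wMeasure, integral_withDensity_eq_integral_toReal_smul (by fun_prop) (by simp)]
  simp only [ENNReal.toReal_ofReal (Real.exp_pos _).le]

theorem integrable_wMeasure_iff (κ : ℝ) (F : ℝ → E) :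
    Integrable F (wMeasure κ) ↔ IntegrableOn (fun t => Real.exp (-κ * t) • F t) (Ioi 0) := by
  rw [wMeasure, integrable_withDensity_iff_integrable_smul' (by fun_prop) (by simp)]
  simp only [ENNReal.toReal_ofReal (Real.exp_pos _).le]
  rfl

theorem L2w_ext {u v : L2w κ H} (h : u =ᵐ[volume.restrict (Ioi (0 : ℝ))] v) : u = v :=
  Lp.ext ((ae_wMeasure_iff κ).mpr h)

theorem ae_coeFn_add (u v : L2w κ H) : (u + v : L2w κ H) =ᵐ[volume.restrict (Ioi (0 : ℝ))] u + v :=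
  (ae_wMeasure_iff κ).mp (Lp.coeFn_add u v)

theorem ae_coeFn_sub (u v : L2w κ H) : (u - v : L2w κ H) =ᵐ[volume.restrict (Ioi (0 : ℝ))] u - v :=
  (ae_wMeasure_iff κ).mp (Lp.coeFn_sub u v)

theorem integrableOn_norm_sq_L2w (u : L2w κ H) :
    IntegrableOn (fun t => Real.exp (-κ * t) * ‖u t‖ ^ 2) (Ioi 0) :=
  (integrable_wMeasure_iff κ _).mp <|
    (memLp_two_iff_integrable_sq_norm (Lp.memLp u).1).mp (Lp.memLp u)

variable [InnerProductSpace ℂ H]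

theorem ae_coeFn_smul (c : ℂ) (u : L2w κ H) :
    (c • u : L2w κ H) =ᵐ[volume.restrict (Ioi (0 : ℝ))] c • ⇑u :=
  (ae_wMeasure_iff κ).mp (Lp.coeFn_smul c u)

theorem locInt_L2w (u : L2w κ H) : LocInt u := fun T => by
  obtain ⟨ψ, hψ_one, -, hψ_supp, -⟩ := exists_continuous_one_zero_of_isCompact
    (X := ℝ) (isCompact_Icc (a := 0) (b := T)) isClosed_empty (disjoint_empty _)
  have hψu : IntegrableOn (fun t => ψ t • u t) (Ioi 0) :=
    integrable_smul_L2w ψ.continuous hψ_supp u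
  refine (hψu.mono_set Ioc_subset_Ioi_self).congr_fun (fun t ht => ?_) measurableSet_Ioc
  simp [hψ_one (Ioc_subset_Icc_self ht)]

theorem integrableOn_inner_L2w (u v : L2w κ H) :
    IntegrableOn (fun t => Real.exp (-κ * t) * inner ℝ (u t) (v t)) (Ioi 0) := by
  have h := (integrable_wMeasure_iff κ _).mp (L2.integrable_inner (𝕜 := ℂ) u v)
  refine h.re.congr (ae_of_all _ fun t => ?_)
  simp only [RCLike.re_eq_complex_re, Complex.real_smul, Complex.re_ofReal_mul]
  rfl

theorem re_inner_L2w (u v : L2w κ H) :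
    (inner ℂ u v).re = ∫ t in Ioi 0, Real.exp (-κ * t) * inner ℝ (u t) (v t) := by
  have h := (integrable_wMeasure_iff κ _).mp (L2.integrable_inner (𝕜 := ℂ) u v)
  rw [L2.inner_def, integral_wMeasure, ← RCLike.re_eq_complex_re, ← integral_re h]
  refine integral_congr_ae (ae_of_all _ fun t => ?_)
  simp only [RCLike.re_eq_complex_re, Complex.real_smul, Complex.re_ofReal_mul]
  rfl

theorem norm_sq_L2w (u : L2w κ H) : ‖u‖ ^ 2 = ∫ t in Ioi 0, Real.exp (-κ * t) * ‖u t‖ ^ 2 := by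
  simp_rw [← inner_self_eq_norm_sq (𝕜 := ℂ) u, RCLike.re_eq_complex_re, re_inner_L2w,
    real_inner_self_eq_norm_sq]

/-- The operator `u ↦ T u(·)` in `L_{2,κ}` for a bounded `T`. -/
def lift (κ : ℝ) (T : H →L[ℂ] H) : L2w κ H →L[ℂ] L2w κ H :=
  T.compLpL 2 (wMeasure κ)

theorem lift_ae (T : H →L[ℂ] H) (u : L2w κ H) :
    lift κ T u =ᵐ[volume.restrict (Ioi (0 : ℝ))] fun t => T (u t) :=
  (ae_wMeasure_iff κ).mp (T.coeFn_compLpL u)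

theorem lift_one_sub_smul (c : ℂ) (T : H →L[ℂ] H) : lift κ (1 - c • T) = 1 - c • lift κ T := by
  ext1 u
  refine L2w_ext ?_
  filter_upwards [lift_ae (1 - c • T) u, lift_ae T u, ae_coeFn_sub u (c • lift κ T u),
    ae_coeFn_smul c (lift κ T u)] with t hlift hT hsub hsmul
  change _ = (u - c • lift κ T u : L2w κ H) t
  rw [hlift, hsub, Pi.sub_apply, hsmul, Pi.smul_apply, hT]
  rfl

theorem lift_injective {T : H →L[ℂ] H} (hT : Function.Injective T) :
    Function.Injective (lift κ T) := fun u v h => by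
  refine L2w_ext ?_
  filter_upwards [lift_ae T u, lift_ae T v] with t hu hv
  exact hT (by rw [← hu, ← hv, h])

theorem lift_nonneg {T : H →L[ℂ] H} (hT : 0 ≤ T) : 0 ≤ lift κ T := by
  rw [ContinuousLinearMap.nonneg_iff_isPositive, ContinuousLinearMap.isPositive_def] at hT ⊢
  refine ⟨fun u v => ?_, fun u => ?_⟩
  · rw [L2.inner_def, L2.inner_def]
    refine integral_congr_ae ((ae_wMeasure_iff κ).mpr ?_)
    filter_upwards [lift_ae T u, lift_ae T v] with t hu hv
    rw [ContinuousLinearMap.coe_coe, hu, hv]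
    exact hT.1 _ _
  · rw [ContinuousLinearMap.reApplyInnerSelf_apply, RCLike.re_eq_complex_re, re_inner_L2w]
    refine setIntegral_nonneg_of_ae_restrict ?_
    filter_upwards [lift_ae T u] with t hu
    rw [hu]
    exact mul_nonneg (Real.exp_pos _).le (hT.2 (u t))

end Weighted

/-! ### The Volterra operator `(d/dt + ν)⁻¹` -/

section VolterraFun

variable {E : Type*} [NormedAddCommGroup E] [NormedSpace ℝ E] {f g : ℝ → E}

/-- The solution of `y' + ν y = f`, `y(0) = 0`, on the half-line. -/
def volterraFun (ν : ℝ) (f : ℝ → E) (t : ℝ) : E :=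
  Real.exp (-ν * t) • prim (fun s => Real.exp (ν * s) • f s) t

theorem LocInt.exp_smul (hf : LocInt f) (ν : ℝ) : LocInt fun s => Real.exp (ν * s) • f s :=
  hf.smul (by fun_prop)

theorem continuous_volterraFun (ν : ℝ) (hf : LocInt f) : Continuous (volterraFun ν f) :=
  Continuous.smul (by fun_prop) (continuous_prim (hf.exp_smul ν))

theorem volterraFun_congr_ae {ν : ℝ} (h : f =ᵐ[volume.restrict (Ioi 0)] g) :
    volterraFun ν f = volterraFun ν g := by
  funext t
  rw [volterraFun, volterraFun, prim_congr_ae (h.mono fun s hs => by rw [hs])]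

theorem volterraFun_add (ν : ℝ) (hf : LocInt f) (hg : LocInt g) (t : ℝ) :
    volterraFun ν (f + g) t = volterraFun ν f t + volterraFun ν g t := by
  simp only [volterraFun, Pi.add_apply, smul_add]
  rw [prim_add (hf.exp_smul ν) (hg.exp_smul ν), smul_add]

theorem volterraFun_clm {F : Type*} [NormedAddCommGroup F] [NormedSpace ℝ F] [CompleteSpace E]
    [CompleteSpace F] (ν : ℝ) (hf : LocInt f) (L : E →L[ℝ] F) (t : ℝ) :
    volterraFun ν (fun s => L (f s)) t = L (volterraFun ν f t) := by
  have h := prim_clm L (hf.exp_smul ν) t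
  simp only [map_smul] at h
  rw [volterraFun, volterraFun, h, map_smul]

theorem deriv_exp_const_mul (ν : ℝ) :
    (deriv fun t : ℝ => Real.exp (ν * t)) = fun t => ν * Real.exp (ν * t) := by
  funext t
  simpa [mul_comm] using ((hasDerivAt_id t).const_mul ν).exp.deriv

end VolterraFun

section Energy

variable {E : Type*} [NormedAddCommGroup E] [InnerProductSpace ℝ E] {f : ℝ → E}

theorem two_mul_inner_le {c : ℝ} (hc : 0 < c) (x y : E) :
    2 * inner ℝ x y ≤ c / 2 * ‖y‖ ^ 2 + 2 / c * ‖x‖ ^ 2 := by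
  have hsq : c / 2 * ‖y‖ ^ 2 + 2 / c * ‖x‖ ^ 2 - 2 * (‖x‖ * ‖y‖) =
      2 / c * (c / 2 * ‖y‖ - ‖x‖) ^ 2 := by
    field_simp
    ring
  have hnonneg : 0 ≤ 2 / c * (c / 2 * ‖y‖ - ‖x‖) ^ 2 := by positivity
  linarith [real_inner_le_norm x y]

theorem LocInt.exp_mul_inner_volterraFun (hf : LocInt f) (ν κ : ℝ) :
    LocInt fun t => Real.exp (-κ * t) * inner ℝ (f t) (volterraFun ν f t) :=
  (hf.inner_of_continuous (continuous_volterraFun ν hf)).exp_smul (-κ)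

theorem LocInt.exp_mul_norm_sq_volterraFun (hf : LocInt f) (ν κ : ℝ) :
    LocInt fun t => Real.exp (-κ * t) * ‖volterraFun ν f t‖ ^ 2 :=
  locInt_of_continuous <| Continuous.mul (by fun_prop) ((continuous_volterraFun ν hf).norm.pow 2)

variable [CompleteSpace E]

theorem mul_prim_norm_sq_volterraFun_le (hf : LocInt f) (ν κ : ℝ) {T : ℝ} (hT : 0 ≤ T) :
    (2 * ν + κ) * prim (fun t => Real.exp (-κ * t) * ‖volterraFun ν f t‖ ^ 2) T ≤
      2 * prim (fun t => Real.exp (-κ * t) * inner ℝ (f t) (volterraFun ν f t)) T := by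
  set F := prim fun s => Real.exp (ν * s) • f s
  have hf' := hf.exp_smul ν
  have hF : LocInt fun t => 2 * inner ℝ (Real.exp (ν * t) • f t) (F t) :=
    (hf'.inner_of_continuous (continuous_prim hf')).smul (φ := fun _ => 2) continuous_const
  have hparts := smul_prim (φ := fun t => Real.exp (-(2 * ν + κ) * t)) (by fun_prop) hF hT
  have hnorm : ∀ t, prim (fun s => 2 * inner ℝ (Real.exp (ν * s) • f s) (F s)) t = ‖F t‖ ^ 2 :=
    fun t => (norm_sq_prim hf' t).symm
  simp only [hnorm, deriv_exp_const_mul] at hparts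
  have hy : ∀ t, volterraFun ν f t = Real.exp (-ν * t) • F t := fun _ => rfl
  have hintegrand : ∀ t, (-(2 * ν + κ) * Real.exp (-(2 * ν + κ) * t)) • ‖F t‖ ^ 2 +
      Real.exp (-(2 * ν + κ) * t) • (2 * inner ℝ (Real.exp (ν * t) • f t) (F t)) =
      (-(2 * ν + κ)) • (Real.exp (-κ * t) * ‖volterraFun ν f t‖ ^ 2) +
        (2 : ℝ) • (Real.exp (-κ * t) * inner ℝ (f t) (volterraFun ν f t)) := fun t => by
    have hexp : Real.exp (-ν * t) * Real.exp (ν * t) = 1 := by rw [← Real.exp_add]; simp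
    rw [hy, norm_smul, Real.norm_of_nonneg (Real.exp_pos _).le, real_inner_smul_left,
      real_inner_smul_right, show -(2 * ν + κ) * t = -κ * t + (-ν * t + -ν * t) by ring,
      Real.exp_add, Real.exp_add]
    simp only [smul_eq_mul]
    linear_combination (2 * Real.exp (-κ * t) * Real.exp (-ν * t) * inner ℝ (f t) (F t)) * hexp
  simp only [hintegrand] at hparts
  rw [prim_add ((hf.exp_mul_norm_sq_volterraFun ν κ).smul continuous_const)
    ((hf.exp_mul_inner_volterraFun ν κ).smul continuous_const), prim_const_smul,
    prim_const_smul, smul_eq_mul, smul_eq_mul, smul_eq_mul] at hparts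
  have hnonneg : 0 ≤ Real.exp (-(2 * ν + κ) * T) * ‖F T‖ ^ 2 := by positivity
  linarith

theorem prim_norm_sq_volterraFun_le (hf : LocInt f) {ν κ : ℝ} (hν : 0 < 2 * ν + κ)
    (hf2 : LocInt fun t => Real.exp (-κ * t) * ‖f t‖ ^ 2) {T : ℝ} (hT : 0 ≤ T) :
    prim (fun t => Real.exp (-κ * t) * ‖volterraFun ν f t‖ ^ 2) T ≤
      (2 / (2 * ν + κ)) ^ 2 * prim (fun t => Real.exp (-κ * t) * ‖f t‖ ^ 2) T := by
  set c := 2 * ν + κ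
  set Y := prim (fun t => Real.exp (-κ * t) * ‖volterraFun ν f t‖ ^ 2) T
  set N := prim (fun t => Real.exp (-κ * t) * ‖f t‖ ^ 2) T
  have hY := hf.exp_mul_norm_sq_volterraFun ν κ
  have hyoung : 2 * prim (fun t => Real.exp (-κ * t) * inner ℝ (f t) (volterraFun ν f t)) T ≤
      c / 2 * Y + 2 / c * N :=
    calc _ = prim (fun t => (2 : ℝ) • (Real.exp (-κ * t) * inner ℝ (f t) (volterraFun ν f t))) T :=
          (prim_const_smul _ _ _).symm
      _ ≤ prim (fun t => (c / 2) • (Real.exp (-κ * t) * ‖volterraFun ν f t‖ ^ 2) +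
            (2 / c) • (Real.exp (-κ * t) * ‖f t‖ ^ 2)) T := by
          refine integral_mono (((hf.exp_mul_inner_volterraFun ν κ).smul continuous_const) T)
            (((hY.smul continuous_const).add (hf2.smul continuous_const)) T) fun t => ?_
          have hpoint := mul_le_mul_of_nonneg_left
            (two_mul_inner_le hν (f t) (volterraFun ν f t)) (Real.exp_pos (-κ * t)).le
          simp only [smul_eq_mul]
          linarith
      _ = c / 2 * Y + 2 / c * N := by
          rw [prim_add (hY.smul continuous_const) (hf2.smul continuous_const), prim_const_smul,
            prim_const_smul, smul_eq_mul, smul_eq_mul]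
  have henergy := mul_prim_norm_sq_volterraFun_le hf ν κ hT
  calc Y = 2 / c * (c / 2 * Y) := by field_simp
    _ ≤ 2 / c * (2 / c * N) := mul_le_mul_of_nonneg_left (by linarith) (by positivity)
    _ = (2 / c) ^ 2 * N := by ring

end Energy

section Volterra

attribute [local instance] InnerProductSpace.complexToReal

variable {H : Type*} [NormedAddCommGroup H] [InnerProductSpace ℂ H] {κ ν : ℝ}

theorem tendsto_prim {E : Type*} [NormedAddCommGroup E] [NormedSpace ℝ E] {g : ℝ → E}
    (hg : IntegrableOn g (Ioi 0)) : Tendsto (prim g) atTop (𝓝 (∫ t in Ioi 0, g t)) :=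
  (intervalIntegral_tendsto_integral_Ioi 0 hg tendsto_id).congr' <|
    (eventually_ge_atTop 0).mono fun _ hT => (prim_eq_intervalIntegral g hT).symm

theorem prim_norm_sq_volterraFun_le_norm_sq [CompleteSpace H] (hν : 0 < 2 * ν + κ)
    (f : L2w κ H) {T : ℝ} (hT : 0 ≤ T) :
    prim (fun t => Real.exp (-κ * t) * ‖volterraFun ν f t‖ ^ 2) T ≤
      (2 / (2 * ν + κ) * ‖f‖) ^ 2 := by
  have hf := integrableOn_norm_sq_L2w f
  have hle : prim (fun t => Real.exp (-κ * t) * ‖f t‖ ^ 2) T ≤ ‖f‖ ^ 2 := by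
    rw [norm_sq_L2w]
    exact setIntegral_mono_set hf (ae_of_all _ fun t => by positivity)
      Ioc_subset_Ioi_self.eventuallyLE
  calc _ ≤ _ := prim_norm_sq_volterraFun_le (locInt_L2w f) hν
          (fun T => hf.mono_set Ioc_subset_Ioi_self) hT
    _ ≤ (2 / (2 * ν + κ)) ^ 2 * ‖f‖ ^ 2 := mul_le_mul_of_nonneg_left hle (sq_nonneg _)
    _ = (2 / (2 * ν + κ) * ‖f‖) ^ 2 := (mul_pow _ _ 2).symm

theorem memLp_volterraFun [CompleteSpace H] (hν : 0 < 2 * ν + κ) (f : L2w κ H) :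
    MemLp (volterraFun ν f) 2 (wMeasure κ) := by
  have hint := (locInt_L2w f).exp_mul_norm_sq_volterraFun ν κ
  rw [memLp_two_iff_integrable_sq_norm
    (continuous_volterraFun ν (locInt_L2w f)).aestronglyMeasurable, integrable_wMeasure_iff]
  refine integrableOn_Ioi_of_intervalIntegral_norm_bounded ((2 / (2 * ν + κ) * ‖f‖) ^ 2) 0 hint
    tendsto_id ?_
  filter_upwards [eventually_ge_atTop 0] with T hT
  rw [← prim_eq_intervalIntegral _ hT]
  refine le_trans (le_of_eq ?_) (prim_norm_sq_volterraFun_le_norm_sq hν f hT)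
  exact congrArg (prim · T) (funext fun t => Real.norm_of_nonneg (by positivity))

variable [CompleteSpace H]

/-- The operator `(d/dt + ν)⁻¹` on `L_{2,κ}` with zero initial value. -/
def volterra (ν : ℝ) (hν : 0 < 2 * ν + κ) : L2w κ H →L[ℂ] L2w κ H :=
  LinearMap.mkContinuous
    { toFun := fun f => (memLp_volterraFun hν f).toLp
      map_add' := fun f g => by
        rw [← MemLp.toLp_add]
        refine MemLp.toLp_congr _ _ (ae_of_all _ fun t => ?_)
        rw [volterraFun_congr_ae (ae_coeFn_add f g),
          volterraFun_add ν (locInt_L2w f) (locInt_L2w g), Pi.add_apply]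
      map_smul' := fun c f => by
        rw [RingHom.id_apply, ← MemLp.toLp_const_smul]
        refine MemLp.toLp_congr _ _ (ae_of_all _ fun t => ?_)
        rw [volterraFun_congr_ae (ae_coeFn_smul c f)]
        exact volterraFun_clm ν (locInt_L2w f)
          ((c • ContinuousLinearMap.id ℂ H).restrictScalars ℝ) t }
    (2 / (2 * ν + κ)) fun f => by
      set y : L2w κ H := (memLp_volterraFun hν f).toLp
      have hy : y =ᵐ[volume.restrict (Ioi (0 : ℝ))] volterraFun ν f :=
        (ae_wMeasure_iff κ).mp (MemLp.coeFn_toLp _)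
      refine (sq_le_sq₀ (norm_nonneg y) (by positivity)).mp ?_
      rw [norm_sq_L2w]
      refine le_of_tendsto (tendsto_prim (integrableOn_norm_sq_L2w y)) ?_
      filter_upwards [eventually_ge_atTop 0] with T hT
      rw [prim_congr_ae (hy.mono fun t ht => by rw [ht])]
      exact prim_norm_sq_volterraFun_le_norm_sq hν f hT

variable (hν : 0 < 2 * ν + κ)

theorem volterra_ae (f : L2w κ H) :
    volterra ν hν f =ᵐ[volume.restrict (Ioi (0 : ℝ))] volterraFun ν f :=
  (ae_wMeasure_iff κ).mp (MemLp.coeFn_toLp (memLp_volterraFun hν f))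

theorem isAccretive_volterra : IsAccretive (volterra (H := H) ν hν) := fun f => by
  rw [re_inner_L2w]
  refine ge_of_tendsto (tendsto_prim (integrableOn_inner_L2w _ f)) ?_
  filter_upwards [eventually_ge_atTop 0] with T hT
  have henergy := mul_prim_norm_sq_volterraFun_le (locInt_L2w f) ν κ hT
  have hnonneg : 0 ≤ prim (fun t => Real.exp (-κ * t) * ‖volterraFun ν f t‖ ^ 2) T :=
    integral_nonneg fun t => by positivity
  rw [prim_congr_ae (g := fun t => Real.exp (-κ * t) * inner ℝ (f t) (volterraFun ν f t))
    ((volterra_ae hν f).mono fun t ht => by rw [ht, real_inner_comm])]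
  linarith [mul_nonneg hν.le hnonneg]

theorem commute_lift_volterra (T : H →L[ℂ] H) : Commute (lift κ T) (volterra ν hν) := by
  ext1 f
  refine L2w_ext ?_
  filter_upwards [lift_ae T (volterra ν hν f), volterra_ae hν f, volterra_ae hν (lift κ T f)]
    with t hlift hf hTf
  have hclm := volterraFun_clm ν (locInt_L2w f) (T.restrictScalars ℝ) t
  change lift κ T (volterra ν hν f) t = volterra ν hν (lift κ T f) t
  rw [hlift, hf, hTf, volterraFun_congr_ae (lift_ae T f)]
  exact hclm.symm

/-- `y` is the primitive of `g` that vanishes at `0`, that is, `y' = g` and `y(0) = 0`. -/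
def HasPrim (y g : L2w κ H) : Prop :=
  y =ᵐ[volume.restrict (Ioi (0 : ℝ))] prim g

theorem hasPrim_volterra (f : L2w κ H) :
    HasPrim (volterra ν hν f) (f - (ν : ℂ) • volterra ν hν f) := by
  have hφ : ContDiff ℝ 1 fun t : ℝ => Real.exp (-ν * t) := by fun_prop
  have hae : (f - (ν : ℂ) • volterra ν hν f : L2w κ H) =ᵐ[volume.restrict (Ioi (0 : ℝ))]
      fun s => (-ν * Real.exp (-ν * s)) • prim (fun s => Real.exp (ν * s) • f s) s +
        Real.exp (-ν * s) • Real.exp (ν * s) • f s := by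
    filter_upwards [volterra_ae hν f, ae_coeFn_sub f ((ν : ℂ) • volterra ν hν f),
      ae_coeFn_smul (ν : ℂ) (volterra ν hν f)] with s hs hsub hsmul
    rw [hsub, Pi.sub_apply, hsmul, Pi.smul_apply, hs, volterraFun, smul_smul (Real.exp _),
      ← Real.exp_add, neg_mul, neg_add_cancel, Real.exp_zero, one_smul, Complex.coe_smul,
      smul_smul, neg_mul, neg_smul]
    abel
  filter_upwards [volterra_ae hν f, ae_restrict_mem measurableSet_Ioi] with t ht ht0
  have hparts := smul_prim hφ ((locInt_L2w f).exp_smul ν) (le_of_lt ht0)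
  rw [deriv_exp_const_mul] at hparts
  rw [ht, volterraFun, hparts, prim_congr_ae hae]

theorem volterra_add_smul_of_hasPrim {y g : L2w κ H} (h : HasPrim y g) :
    volterra ν hν (g + (ν : ℂ) • y) = y := by
  have hφ : ContDiff ℝ 1 fun t : ℝ => Real.exp (ν * t) := by fun_prop
  have hae : (fun s => Real.exp (ν * s) • (g + (ν : ℂ) • y : L2w κ H) s)
      =ᵐ[volume.restrict (Ioi (0 : ℝ))]
      fun s => (ν * Real.exp (ν * s)) • prim g s + Real.exp (ν * s) • g s := by
    filter_upwards [h, ae_coeFn_add g ((ν : ℂ) • y), ae_coeFn_smul (ν : ℂ) y]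
      with s hs hadd hsmul
    rw [hadd, Pi.add_apply, hsmul, Pi.smul_apply, hs, smul_add, Complex.coe_smul, smul_smul,
      mul_comm ν (Real.exp _), add_comm]
  refine L2w_ext ?_
  filter_upwards [volterra_ae hν (g + (ν : ℂ) • y), h, ae_restrict_mem measurableSet_Ioi]
    with t hvolterra ht ht0
  have hparts := smul_prim hφ (locInt_L2w g) (le_of_lt ht0)
  rw [deriv_exp_const_mul] at hparts
  rw [hvolterra, ht, volterraFun, prim_congr_ae hae, ← hparts, smul_smul, ← Real.exp_add, neg_mul,
    neg_add_cancel, Real.exp_zero, one_smul]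

theorem hasPrim_iff_volterra_eq {y g : L2w κ H} :
    HasPrim y g ↔ volterra ν hν (g + (ν : ℂ) • y) = y := by
  refine ⟨volterra_add_smul_of_hasPrim hν, fun h => ?_⟩
  simpa only [h, add_sub_cancel_right] using hasPrim_volterra hν (g + (ν : ℂ) • y)

end Volterra

/-! ### Test functions and generalized derivatives -/

section TestFunctions

variable {φ ψ : ℝ → ℝ}

theorem IsTest.deriv (h : IsTest φ) : IsTest (deriv φ) :=
  ⟨(contDiff_infty_iff_deriv.mp h.1).2, h.2.1.deriv, tsupport_deriv_subset.trans h.2.2⟩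

theorem IsTest.iteratedDeriv (h : IsTest φ) (n : ℕ) : IsTest (iteratedDeriv n φ) := by
  induction n with
  | zero => rwa [iteratedDeriv_zero]
  | succ n ih => rw [iteratedDeriv_succ]; exact ih.deriv

theorem IsTest.mul_left (h : IsTest φ) {e : ℝ → ℝ} (he : ContDiff ℝ ∞ e) :
    IsTest fun t => e t * φ t :=
  ⟨he.mul h.1, h.2.1.mul_left, tsupport_mul_subset_right.trans h.2.2⟩

theorem IsTest.add (h : IsTest φ) (h' : IsTest ψ) : IsTest fun t => φ t + ψ t :=
  ⟨h.1.add h'.1, h.2.1.add h'.2.1, (tsupport_add φ ψ).trans (union_subset h.2.2 h'.2.2)⟩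

theorem IsTest.sub (h : IsTest φ) (h' : IsTest ψ) : IsTest fun t => φ t - ψ t :=
  ⟨h.1.sub h'.1, h.2.1.sub h'.2.1, (tsupport_sub φ ψ).trans (union_subset h.2.2 h'.2.2)⟩

theorem IsTest.eq_zero_of_nonpos (h : IsTest φ) {t : ℝ} (ht : t ≤ 0) : φ t = 0 :=
  image_eq_zero_of_notMem_tsupport fun hmem => not_lt.mpr ht (h.2.2 hmem)

theorem IsTest.exists_Icc (h : IsTest φ) : ∃ a b : ℝ, 0 < a ∧ ∀ t, t ∉ Icc a b → φ t = 0 := by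
  rcases (tsupport φ).eq_empty_or_nonempty with hempty | hne
  · exact ⟨1, 1, one_pos, fun t _ =>
      image_eq_zero_of_notMem_tsupport (hempty ▸ notMem_empty t)⟩
  · have hc : IsCompact (tsupport φ) := h.2.1
    refine ⟨sInf (tsupport φ), sSup (tsupport φ), h.2.2 (hc.sInf_mem hne), fun t ht => ?_⟩
    refine image_eq_zero_of_notMem_tsupport fun hmem => ht ?_
    exact ⟨csInf_le hc.bddBelow hmem, le_csSup hc.bddAbove hmem⟩

theorem isTest_of_Icc (h : ContDiff ℝ ∞ φ) {a b : ℝ} (ha : 0 < a)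
    (hzero : ∀ t, t ∉ Icc a b → φ t = 0) : IsTest φ := by
  have hsupp : tsupport φ ⊆ Icc a b :=
    closure_minimal (fun t ht => by_contra fun hmem => ht (hzero t hmem)) isClosed_Icc
  exact ⟨h, HasCompactSupport.intro isCompact_Icc hzero, fun t ht => ha.trans_le (hsupp ht).1⟩

theorem IsTest.comp_sub_const (h : IsTest φ) {T : ℝ} (hT : 0 ≤ T) :
    IsTest fun t => φ (t - T) := by
  obtain ⟨a, b, ha, hzero⟩ := h.exists_Icc
  refine isTest_of_Icc (h.1.comp (by fun_prop)) (b := b + T) ha fun t ht => ?_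
  refine hzero _ fun hmem => ht ?_
  exact ⟨by linarith [hmem.1], by linarith [hmem.2]⟩

theorem IsTest.integrable (h : IsTest φ) : Integrable φ :=
  h.1.continuous.integrable_of_hasCompactSupport h.2.1

theorem IsTest.exists_deriv_eq (h : IsTest φ) (hmean : ∫ t, φ t = 0) :
    ∃ θ, IsTest θ ∧ _root_.deriv θ = φ := by
  obtain ⟨a, b, ha, hzero⟩ := h.exists_Icc
  have hderiv : ∀ t, HasDerivAt (fun t => ∫ s in (0 : ℝ)..t, φ s) (φ t) t := fun t =>
    (h.1.continuous.integral_hasStrictDerivAt 0 t).hasDerivAt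
  have hderiv_eq : _root_.deriv (fun t => ∫ s in (0 : ℝ)..t, φ s) = φ :=
    funext fun t => (hderiv t).deriv
  refine ⟨_, isTest_of_Icc (a := a) (b := b) ?_ ha fun t ht => ?_, hderiv_eq⟩
  · refine contDiff_infty_iff_deriv.mpr ⟨fun t => (hderiv t).differentiableAt, ?_⟩
    rw [hderiv_eq]
    exact h.1
  · rcases lt_or_ge t a with hta | hat
    · refine intervalIntegral.integral_zero_ae (ae_of_all _ fun s hs => hzero s fun hmem => ?_)
      exact hmem.1.not_gt (hs.2.trans_lt (max_lt ha hta))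
    · rw [intervalIntegral.integral_of_le (ha.le.trans hat)]
      refine (setIntegral_eq_integral_of_forall_compl_eq_zero fun s hs => ?_).trans hmean
      refine hzero s fun hmem => hs ?_
      exact ⟨ha.trans_le hmem.1, hmem.2.trans (not_le.mp fun htb => ht ⟨hat, htb⟩).le⟩

theorem IsTest.exists_deriv_eq_sub_translate (h : IsTest φ) {T : ℝ} (hT : 0 ≤ T) :
    ∃ θ, IsTest θ ∧ _root_.deriv θ = fun t => φ t - φ (t - T) := by
  refine (h.sub (h.comp_sub_const hT)).exists_deriv_eq ?_
  rw [integral_sub h.integrable (h.comp_sub_const hT).integrable, integral_sub_right_eq_self φ T,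
    sub_self]

theorem exists_isTest_integral_eq_one : ∃ χ, IsTest χ ∧ ∫ t, χ t = 1 := by
  let χ : ContDiffBump (2 : ℝ) := ⟨1 / 2, 1, by norm_num, by norm_num⟩
  refine ⟨χ.normed volume, ⟨χ.contDiff_normed, χ.hasCompactSupport_normed, ?_⟩, χ.integral_normed⟩
  rw [χ.tsupport_normed_eq, Real.closedBall_eq_Icc]
  exact fun t ht => lt_of_lt_of_le (by norm_num) ht.1

end TestFunctions

section Pairing

variable {E : Type*} [NormedAddCommGroup E] [NormedSpace ℝ E] {φ : ℝ → ℝ} {f g z : ℝ → E}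

theorem IsTest.integrable_smul (h : IsTest φ) (hz : LocInt z) :
    Integrable (fun t => φ t • z t) (volume.restrict (Ioi 0)) := by
  obtain ⟨_, b, _, hzero⟩ := h.exists_Icc
  refine (hz.smul h.1.continuous b).of_forall_sdiff_eq_zero measurableSet_Ioi fun t ht => ?_
  rw [hzero t fun hmem => ht.2 ⟨ht.1, hmem.2⟩, zero_smul]

theorem IsTest.tendsto_integral_translate_smul (hφ : IsTest φ) (hz : IntegrableOn z (Ioi 0)) :
    Tendsto (fun T : ℝ => ∫ t in Ioi 0, φ (t - T) • z t) atTop (𝓝 0) := by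
  obtain ⟨C, hC⟩ := hφ.2.1.exists_bound_of_continuous hφ.1.continuous
  rw [← integral_zero (α := ℝ) (G := E) (μ := volume.restrict (Ioi 0))]
  refine tendsto_integral_filter_of_dominated_convergence (fun t => C * ‖z t‖)
    (Eventually.of_forall fun T => ?_) (Eventually.of_forall fun T => ae_of_all _ fun t => ?_)
    (hz.norm.const_mul C) (ae_of_all _ fun t => ?_)
  · exact (hφ.1.continuous.comp (by fun_prop)).aestronglyMeasurable.smul hz.aestronglyMeasurable
  · rw [norm_smul]
    gcongr
    exact hC _
  · refine tendsto_const_nhds.congr' ?_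
    filter_upwards [eventually_ge_atTop t] with T hT
    rw [hφ.eq_zero_of_nonpos (sub_nonpos.mpr hT), zero_smul]

theorem integral_iteratedDeriv_translate_smul (hz : IntegrableOn z (Ioi 0)) {n : ℕ}
    (h : ∀ φ, IsTest φ → ∫ t in Ioi 0, iteratedDeriv (n + 1) φ t • z t = 0) (hφ : IsTest φ)
    {T : ℝ} (hT : 0 ≤ T) :
    ∫ t in Ioi 0, iteratedDeriv n φ (t - T) • z t = ∫ t in Ioi 0, iteratedDeriv n φ t • z t := by
  obtain ⟨θ, hθ, hderiv⟩ := hφ.exists_deriv_eq_sub_translate hT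
  have hn : ContDiff ℝ n φ := hφ.1.of_le (mod_cast le_top)
  have hn' : ContDiff ℝ n fun t => φ (t - T) := hn.comp (by fun_prop)
  have hzero : ∀ t, iteratedDeriv (n + 1) θ t =
      iteratedDeriv n φ t - iteratedDeriv n φ (t - T) := fun t => by
    rw [iteratedDeriv_succ', hderiv, iteratedDeriv_fun_sub hn.contDiffAt hn'.contDiffAt,
      iteratedDeriv_comp_sub_const]
  obtain ⟨C, hC⟩ := (hφ.hasCompactSupport_iteratedDeriv n).exists_bound_of_continuous
    (hφ.continuous_iteratedDeriv n)
  have hint : ∀ T, IntegrableOn (fun t => iteratedDeriv n φ (t - T) • z t) (Ioi 0) := fun T =>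
    Integrable.bdd_smul (𝕜 := ℝ) hz C
      ((hφ.continuous_iteratedDeriv n).comp (by fun_prop)).aestronglyMeasurable
      (ae_of_all _ fun t => hC (t - T))
  have hsub := h θ hθ
  simp only [hzero, sub_smul] at hsub
  rw [integral_sub (by simpa only [IntegrableOn, sub_zero] using hint 0) (hint T)] at hsub
  exact (sub_eq_zero.mp hsub).symm

variable [CompleteSpace E]

theorem ae_eq_zero_of_forall_isTest (hz : LocInt z)
    (h : ∀ φ, IsTest φ → ∫ t in Ioi 0, φ t • z t = 0) :
    ∀ᵐ t ∂volume.restrict (Ioi (0 : ℝ)), z t = 0 := by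
  have hloc : LocallyIntegrableOn z (Ioi (0 : ℝ)) := by
    rw [locallyIntegrableOn_iff isOpen_Ioi.isLocallyClosed]
    intro K hK hKc
    obtain ⟨b, hb⟩ := hKc.bddAbove
    exact (hz b).mono_set fun t ht => ⟨hK ht, hb ht⟩
  rw [ae_restrict_iff' measurableSet_Ioi]
  refine isOpen_Ioi.ae_eq_zero_of_integral_contDiff_smul_eq_zero hloc fun φ hφ hc hs => ?_
  rw [← h φ ⟨hφ, hc, hs⟩]
  refine (setIntegral_eq_integral_of_forall_compl_eq_zero fun t ht => ?_).symm
  rw [image_eq_zero_of_notMem_tsupport fun hmem => ht (hs hmem), zero_smul]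

theorem ae_eq_zero_of_forall_iteratedDeriv (hz : IntegrableOn z (Ioi 0)) (n : ℕ)
    (h : ∀ φ, IsTest φ → ∫ t in Ioi 0, iteratedDeriv n φ t • z t = 0) :
    ∀ᵐ t ∂volume.restrict (Ioi (0 : ℝ)), z t = 0 := by
  induction n with
  | zero =>
    exact ae_eq_zero_of_forall_isTest (fun T => hz.mono_set Ioc_subset_Ioi_self)
      (by simpa only [iteratedDeriv_zero] using h)
  | succ n ih =>
    -- The pairing with `φ⁽ⁿ⁾` does not change when `φ` is moved to infinity, where it vanishes.
    refine ih fun φ hφ => tendsto_nhds_unique (tendsto_const_nhds.congr' ?_)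
      ((hφ.iteratedDeriv n).tendsto_integral_translate_smul hz)
    filter_upwards [eventually_ge_atTop 0] with T hT
    exact (integral_iteratedDeriv_translate_smul hz h hφ hT).symm

theorem IsTest.integral_deriv_smul_prim (hφ : IsTest φ) (hg : LocInt g) :
    ∫ t in Ioi 0, _root_.deriv φ t • prim g t = -∫ t in Ioi 0, φ t • g t := by
  obtain ⟨a, b, _, hzero⟩ := hφ.exists_Icc
  obtain ⟨a', b', _, hzero'⟩ := hφ.deriv.exists_Icc
  obtain ⟨T, hT, hbT, hbT'⟩ : ∃ T : ℝ, 0 ≤ T ∧ b < T ∧ b' < T :=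
    ⟨max 0 (max b b') + 1, by positivity,
      by linarith [le_max_right 0 (max b b'), le_max_left b b'],
      by linarith [le_max_right 0 (max b b'), le_max_right b b']⟩
  have htrunc : ∀ (ψ : ℝ → ℝ) (v : ℝ → E), (∀ t, T < t → ψ t = 0) →
      ∫ t in Ioi 0, ψ t • v t = prim (fun t => ψ t • v t) T := fun ψ v hψ => by
    refine setIntegral_eq_of_subset_of_forall_sdiff_eq_zero measurableSet_Ioi Ioc_subset_Ioi_self
      fun t ht => ?_
    rw [hψ t (not_le.mp fun hle => ht.2 ⟨ht.1, hle⟩), zero_smul]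
  rw [htrunc _ _ fun t ht => hzero' t fun h => by linarith [h.2],
    htrunc _ _ fun t ht => hzero t fun h => by linarith [h.2], eq_neg_iff_add_eq_zero]
  have hparts := smul_prim (hφ.1.of_le (by simp)) hg hT
  rw [hzero T fun h => by linarith [h.2], zero_smul] at hparts
  have hint : LocInt fun t => _root_.deriv φ t • prim g t :=
    locInt_of_continuous (hφ.deriv.1.continuous.smul (continuous_prim hg))
  rw [hparts]
  exact (prim_add hint (hg.smul hφ.1.continuous) T).symm

theorem exists_ae_eq_const_of_forall_isTest (hz : LocInt z)
    (h : ∀ φ, IsTest φ → ∫ t in Ioi 0, deriv φ t • z t = 0) :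
    ∃ c, ∀ᵐ t ∂volume.restrict (Ioi (0 : ℝ)), z t = c := by
  obtain ⟨χ, hχ, hmean⟩ := exists_isTest_integral_eq_one
  set c := ∫ t in Ioi 0, χ t • z t
  have hconst : LocInt fun _ => c := locInt_of_continuous continuous_const
  have hzc := ae_eq_zero_of_forall_isTest (z := fun t => z t - c) (fun T => (hz T).sub (hconst T))
    fun φ hφ => by
      have hψ : IsTest fun t => φ t - (∫ s, φ s) * χ t :=
        hφ.sub (hχ.mul_left (e := fun _ => ∫ s, φ s) contDiff_const)
      obtain ⟨θ, hθ, hderiv⟩ := hψ.exists_deriv_eq (by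
        rw [integral_sub hφ.integrable (hχ.integrable.const_mul _), integral_const_mul, hmean,
          mul_one, sub_self])
      have hzero := h θ hθ
      simp only [hderiv, sub_smul, mul_smul] at hzero
      have hmass : ∫ t in Ioi 0, φ t • c = (∫ t, φ t) • c := by
        rw [integral_smul_const, setIntegral_eq_integral_of_forall_compl_eq_zero fun t ht =>
          hφ.eq_zero_of_nonpos (notMem_Ioi.mp ht)]
      have hint : Integrable (fun t => (∫ s, φ s) • χ t • z t) (volume.restrict (Ioi 0)) :=
        (hχ.integrable_smul hz).smul _
      rw [integral_sub (hφ.integrable_smul hz) hint, integral_smul] at hzero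
      simp only [smul_sub]
      rw [integral_sub (hφ.integrable_smul hz) (hφ.integrable_smul hconst), hmass, hzero]
  exact ⟨c, hzc.mono fun t ht => sub_eq_zero.mp ht⟩

theorem ae_eq_of_eqOn_prim (hf : LocInt f) (hg : LocInt g)
    (h : EqOn (prim f) (prim g) (Ioi 0)) : f =ᵐ[volume.restrict (Ioi (0 : ℝ))] g := by
  have hsub := ae_eq_zero_of_forall_isTest (z := fun t => f t - g t)
    (fun T => (hf T).sub (hg T)) fun φ hφ => by
      simp only [smul_sub]
      rw [integral_sub (hφ.integrable_smul hf) (hφ.integrable_smul hg), sub_eq_zero, ← neg_inj,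
        ← hφ.integral_deriv_smul_prim hf, ← hφ.integral_deriv_smul_prim hg]
      exact setIntegral_congr_fun measurableSet_Ioi fun t ht => congrArg _ (h ht)
  exact hsub.mono fun t ht => sub_eq_zero.mp ht

end Pairing

section WeakDerivatives

variable {H : Type*} [NormedAddCommGroup H] [InnerProductSpace ℂ H] {κ : ℝ} {φ : ℝ → ℝ}

theorem IsTest.integral_smul_sub (h : IsTest φ) (u v : L2w κ H) :
    ∫ t in Ioi 0, φ t • (u - v) t = (∫ t in Ioi 0, φ t • u t) - ∫ t in Ioi 0, φ t • v t := by
  rw [← integral_sub (h.integrable_smul (locInt_L2w u)) (h.integrable_smul (locInt_L2w v))]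
  refine integral_congr_ae ?_
  filter_upwards [ae_coeFn_sub u v] with t ht
  rw [ht, Pi.sub_apply, smul_sub]

theorem integral_smul_smul (φ : ℝ → ℝ) (c : ℂ) (u : L2w κ H) :
    ∫ t in Ioi 0, φ t • (c • u) t = c • ∫ t in Ioi 0, φ t • u t := by
  rw [← integral_smul]
  refine integral_congr_ae ?_
  filter_upwards [ae_coeFn_smul c u] with t ht
  rw [ht, Pi.smul_apply, smul_comm]

theorem mem_weakDerivGraph_one {u g : L2w κ H} : (u, g) ∈ weakDerivGraph κ H 1 ↔
    ∀ φ : ℝ → ℝ, IsTest φ → ∫ t in Ioi 0, deriv φ t • u t = -∫ t in Ioi 0, φ t • g t := by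
  change (∀ φ : ℝ → ℝ, IsTest φ → ∫ t in Ioi 0, iteratedDeriv 1 φ t • u t =
    (-1 : ℝ) ^ 1 • ∫ t in Ioi 0, φ t • g t) ↔ _
  simp only [iteratedDeriv_one, pow_one, neg_smul, one_smul]

theorem mem_weakDerivGraph_succ {n : ℕ} {u v g : L2w κ H} (h : (u, v) ∈ weakDerivGraph κ H 1)
    (h' : (v, g) ∈ weakDerivGraph κ H n) : (u, g) ∈ weakDerivGraph κ H (n + 1) := by
  intro φ hφ
  have hv : ∫ t in Ioi 0, iteratedDeriv n φ t • v t = (-1 : ℝ) ^ n • ∫ t in Ioi 0, φ t • g t :=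
    h' φ hφ
  rw [iteratedDeriv_succ]
  refine (mem_weakDerivGraph_one.mp h _ (hφ.iteratedDeriv n)).trans ?_
  rw [hv, pow_succ, mul_neg, mul_one, neg_smul]

theorem HasPrim.mem_weakDerivGraph [CompleteSpace H] {y g : L2w κ H} (h : HasPrim y g) :
    (y, g) ∈ weakDerivGraph κ H 1 := by
  rw [mem_weakDerivGraph_one]
  intro φ hφ
  rw [← hφ.integral_deriv_smul_prim (locInt_L2w g)]
  refine integral_congr_ae ?_
  filter_upwards [h] with t ht
  rw [ht]

end WeakDerivatives

/-! ### The operator `(-d/dt + m)⁻¹` -/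

section ShiftDeriv

variable {φ : ℝ → ℝ}

/-- The operator `d/dt + m` on scalar functions. On test functions it is the transpose of
`-d/dt + m` with respect to the pairing `∫ φ u`. -/
def shiftDeriv (m : ℝ) (φ : ℝ → ℝ) (t : ℝ) : ℝ := deriv φ t + m * φ t

theorem IsTest.shiftDeriv (h : IsTest φ) (m : ℝ) : IsTest (shiftDeriv m φ) :=
  h.deriv.add (h.mul_left (e := fun _ => m) contDiff_const)

theorem IsTest.shiftDeriv_iterate (h : IsTest φ) (m : ℝ) (n : ℕ) :
    IsTest ((WeightedODE.shiftDeriv m)^[n] φ) := by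
  induction n with
  | zero => exact h
  | succ n ih => rw [Function.iterate_succ_apply']; exact ih.shiftDeriv m

theorem deriv_exp_mul (h : IsTest φ) (c : ℝ) :
    deriv (fun t => Real.exp (c * t) * φ t) =
      fun t => Real.exp (c * t) * shiftDeriv c φ t := by
  funext t
  rw [deriv_fun_mul (by fun_prop) (h.1.differentiable (by simp) t), deriv_exp_const_mul,
    shiftDeriv]
  ring

theorem deriv_shiftDeriv (h : IsTest φ) (m : ℝ) :
    deriv (shiftDeriv m φ) =
      shiftDeriv m (deriv φ) := by
  funext t
  have hφ := h.1.differentiable (by simp) t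
  exact (deriv_fun_add (h.deriv.1.differentiable (by simp) t) (hφ.const_mul m)).trans
    (congrArg _ (deriv_const_mul m hφ))

theorem deriv_shiftDeriv_iterate (h : IsTest φ) (m : ℝ) (n : ℕ) :
    deriv ((shiftDeriv m)^[n] φ) =
      (shiftDeriv m)^[n] (deriv φ) := by
  induction n with
  | zero => rfl
  | succ n ih =>
    rw [Function.iterate_succ_apply', Function.iterate_succ_apply',
      deriv_shiftDeriv (h.shiftDeriv_iterate m n), ih]

theorem shiftDeriv_iterate_exp_mul (h : IsTest φ) (m : ℝ) (n : ℕ) :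
    (shiftDeriv m)^[n] (fun t => Real.exp (-m * t) * φ t) =
      fun t => Real.exp (-m * t) * iteratedDeriv n φ t := by
  induction n with
  | zero => rfl
  | succ n ih =>
    funext t
    have hderiv := congrFun (deriv_exp_mul (h.iteratedDeriv n) (-m)) t
    rw [Function.iterate_succ_apply', ih, shiftDeriv, hderiv, shiftDeriv, iteratedDeriv_succ]
    ring

end ShiftDeriv

section AntiVolterra

variable {H : Type*} [NormedAddCommGroup H] [InnerProductSpace ℂ H] {κ m : ℝ} {φ : ℝ → ℝ}

theorem integral_shiftDeriv_smul (hφ : IsTest φ) (m : ℝ) (u : L2w κ H) :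
    ∫ t in Ioi 0, shiftDeriv m φ t • u t =
      (∫ t in Ioi 0, deriv φ t • u t) + (m : ℂ) • ∫ t in Ioi 0, φ t • u t := by
  have hm : Integrable (fun t => m • φ t • u t) (volume.restrict (Ioi 0)) :=
    Integrable.smul m (hφ.integrable_smul (z := u) (locInt_L2w u))
  simp only [shiftDeriv, add_smul, mul_smul]
  rw [integral_add (hφ.deriv.integrable_smul (locInt_L2w u)) hm, integral_smul, Complex.coe_smul]

theorem IsTest.memLp_exp_mul_smul (hφ : IsTest φ) (h : H) :
    MemLp (fun t => (Real.exp (κ * t) * φ t) • h) 2 (wMeasure κ) := by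
  have : IsLocallyFiniteMeasure (wMeasure κ) :=
    IsLocallyFiniteMeasure.withDensity_coe
      (f := fun t => Real.toNNReal (Real.exp (-κ * t))) (by fun_prop)
  have hcont : Continuous φ := hφ.1.continuous
  have hcont' : Continuous fun t => (Real.exp (κ * t) * φ t) • h := by fun_prop
  exact hcont'.memLp_of_hasCompactSupport hφ.2.1.mul_left.smul_right

/-- The element `t ↦ e^{κt} φ(t) h` of `L_{2,κ}`. The factor `e^{κt}` cancels the weight, so that
the inner product with it is the pairing with the test function `φ` in the direction `h`. -/
def testVec (κ : ℝ) (hφ : IsTest φ) (h : H) : L2w κ H := (hφ.memLp_exp_mul_smul h).toLp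

theorem testVec_ae (hφ : IsTest φ) (h : H) :
    testVec κ hφ h =ᵐ[volume.restrict (Ioi (0 : ℝ))] fun t => (Real.exp (κ * t) * φ t) • h :=
  (ae_wMeasure_iff κ).mp (MemLp.coeFn_toLp _)

theorem integrableOn_exp_smul_L2w (hm : 0 < 2 * (m - κ) + κ) (y : L2w κ H) :
    IntegrableOn (fun t => Real.exp (-m * t) • y t) (Ioi 0) := by
  have hexp : MemLp (fun t => Real.exp ((κ - m) * t)) 2 (wMeasure κ) := by
    rw [memLp_two_iff_integrable_sq_norm (Continuous.aestronglyMeasurable (by fun_prop)),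
      integrable_wMeasure_iff]
    refine (exp_neg_integrableOn_Ioi 0 hm).congr (ae_of_all _ fun t => ?_)
    simp only [Real.norm_of_nonneg (Real.exp_pos _).le, smul_eq_mul, pow_two]
    rw [← Real.exp_add, ← Real.exp_add]
    congr 1
    ring
  have hsmul : Integrable (fun t => Real.exp ((κ - m) * t) • y t) (wMeasure κ) :=
    memLp_one_iff_integrable.mp
      (MemLp.smul (𝕜 := ℝ) (p := 2) (q := 2) (r := 1) (Lp.memLp y) hexp)
  rw [integrable_wMeasure_iff] at hsmul
  refine hsmul.congr (ae_of_all _ fun t => ?_)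
  simp only [smul_smul]
  rw [← Real.exp_add]
  congr 2
  ring

variable [CompleteSpace H]

theorem inner_testVec (hφ : IsTest φ) (h : H) (u : L2w κ H) :
    inner ℂ (testVec κ hφ h) u = inner ℂ h (∫ t in Ioi 0, φ t • u t) := by
  rw [← integral_inner (hφ.integrable_smul (z := u) (locInt_L2w u)), L2.inner_def,
    integral_wMeasure]
  refine integral_congr_ae ?_
  filter_upwards [testVec_ae (κ := κ) hφ h] with t ht
  have hexp : (Real.exp (-κ * t) : ℂ) * Real.exp (κ * t) = 1 := by
    rw [← Complex.ofReal_mul, ← Real.exp_add, neg_mul, neg_add_cancel, Real.exp_zero,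
      Complex.ofReal_one]
  rw [ht, ← Complex.coe_smul, ← Complex.coe_smul, ← Complex.coe_smul, inner_smul_left,
    inner_smul_right, Complex.conj_ofReal, Complex.ofReal_mul, smul_eq_mul, ← mul_assoc,
    ← mul_assoc, hexp, one_mul]

theorem hasPrim_testVec (hφ : IsTest φ) (h : H) :
    HasPrim (testVec κ hφ h) (testVec κ (hφ.shiftDeriv κ) h) := by
  have hexp : ContDiff ℝ ∞ fun t => Real.exp (κ * t) := by fun_prop
  filter_upwards [testVec_ae (κ := κ) hφ h, ae_restrict_mem measurableSet_Ioi] with t ht ht0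
  have hprim := prim_deriv ((hφ.mul_left hexp).1.of_le (by simp)) (le_of_lt ht0)
  rw [hφ.eq_zero_of_nonpos le_rfl, mul_zero, sub_zero, deriv_exp_mul hφ] at hprim
  rw [ht, prim_congr_ae (testVec_ae (hφ.shiftDeriv κ) h), prim, integral_smul_const, ← hprim, prim]

variable (hm : 0 < 2 * (m - κ) + κ)

/-- The operator `(-d/dt + m)⁻¹` on `L_{2,κ}`. Because of the weight, the adjoint of
`d/dt + (m - κ)` with zero initial value is `-d/dt + m`. -/
def antiVolterra (m : ℝ) (hm : 0 < 2 * (m - κ) + κ) : L2w κ H →L[ℂ] L2w κ H :=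
  ContinuousLinearMap.adjoint (volterra (m - κ) hm)

theorem isAccretive_antiVolterra : IsAccretive (antiVolterra (H := H) m hm) :=
  (isAccretive_volterra hm).adjoint

theorem commute_lift_antiVolterra {T : H →L[ℂ] H} (hT : 0 ≤ T) :
    Commute (lift κ T) (antiVolterra m hm) := by
  have h := (commute_lift_volterra hm T).star_star
  rwa [(IsSelfAdjoint.of_nonneg (lift_nonneg hT)).star_eq] at h

theorem integral_shiftDeriv_smul_antiVolterra (hφ : IsTest φ) (f : L2w κ H) :
    ∫ t in Ioi 0, shiftDeriv m φ t • antiVolterra m hm f t = ∫ t in Ioi 0, φ t • f t := by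
  refine ext_inner_left ℂ fun h => ?_
  have hadj : inner ℂ (testVec κ (hφ.shiftDeriv κ) h + ((m - κ : ℝ) : ℂ) • testVec κ hφ h)
      (antiVolterra m hm f) = inner ℂ (testVec κ hφ h) f := by
    rw [antiVolterra, ContinuousLinearMap.adjoint_inner_right,
      volterra_add_smul_of_hasPrim hm (hasPrim_testVec hφ h)]
  rw [inner_add_left, inner_smul_left, Complex.conj_ofReal, inner_testVec, inner_testVec,
    inner_testVec, ← inner_smul_right, ← inner_add_right, integral_shiftDeriv_smul hφ,
    add_assoc, ← add_smul] at hadj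
  rw [← hadj, integral_shiftDeriv_smul hφ, ← Complex.ofReal_add, add_sub_cancel]

theorem antiVolterra_mem_weakDerivGraph (f : L2w κ H) :
    (antiVolterra m hm f, (m : ℂ) • antiVolterra m hm f - f) ∈ weakDerivGraph κ H 1 := by
  rw [mem_weakDerivGraph_one]
  intro φ hφ
  rw [hφ.integral_smul_sub, ← integral_shiftDeriv_smul_antiVolterra hm hφ f,
    integral_smul_smul, integral_shiftDeriv_smul hφ]
  abel

theorem integral_iterate_shiftDeriv_smul_antiVolterra_pow (hφ : IsTest φ) (f : L2w κ H) (n : ℕ) :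
    ∫ t in Ioi 0, (shiftDeriv m)^[n] φ t • (antiVolterra m hm ^ n) f t =
      ∫ t in Ioi 0, φ t • f t := by
  induction n with
  | zero => rfl
  | succ n ih =>
    rw [Function.iterate_succ_apply', pow_succ', ← ih]
    exact integral_shiftDeriv_smul_antiVolterra hm (hφ.shiftDeriv_iterate m n) _

theorem integral_shiftDeriv_smul_sub_one (hφ : IsTest φ) (f : L2w κ H) :
    ∫ t in Ioi 0, shiftDeriv m φ t • ((m : ℂ) • antiVolterra m hm - 1 : L2w κ H →L[ℂ] L2w κ H) f t =
      -∫ t in Ioi 0, deriv φ t • f t := by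
  change ∫ t in Ioi 0, shiftDeriv m φ t • ((m : ℂ) • antiVolterra m hm f - f : L2w κ H) t = _
  rw [(hφ.shiftDeriv m).integral_smul_sub, integral_smul_smul,
    integral_shiftDeriv_smul_antiVolterra hm hφ, integral_shiftDeriv_smul hφ]
  abel

theorem integral_iterate_shiftDeriv_smul_sub_one_pow (hφ : IsTest φ)
    (f : L2w κ H) (n : ℕ) :
    ∫ t in Ioi 0, (shiftDeriv m)^[n] φ t •
        (((m : ℂ) • antiVolterra m hm - 1 : L2w κ H →L[ℂ] L2w κ H) ^ n) f t =
      (-1 : ℝ) ^ n • ∫ t in Ioi 0, iteratedDeriv n φ t • f t := by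
  induction n generalizing φ with
  | zero => rw [pow_zero, pow_zero, one_smul, iteratedDeriv_zero]; rfl
  | succ n ih =>
    rw [Function.iterate_succ_apply', pow_succ', mul_apply_eq_comp,
      integral_shiftDeriv_smul_sub_one hm (hφ.shiftDeriv_iterate m n),
      deriv_shiftDeriv_iterate hφ, ih hφ.deriv, ← iteratedDeriv_succ', pow_succ, mul_neg,
      mul_one, neg_smul]

theorem eq_zero_of_forall_iterate_shiftDeriv {y : L2w κ H} (hm : 0 < 2 * (m - κ) + κ) (n : ℕ)
    (h : ∀ φ, IsTest φ → ∫ t in Ioi 0, (shiftDeriv m)^[n] φ t • y t = 0) : y = 0 := by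
  have hexp : ContDiff ℝ ∞ fun t => Real.exp (-m * t) := by fun_prop
  have hae := ae_eq_zero_of_forall_iteratedDeriv (integrableOn_exp_smul_L2w hm y) n
    fun ψ hψ => by
      rw [← h _ (hψ.mul_left hexp), shiftDeriv_iterate_exp_mul hψ]
      exact integral_congr_ae (ae_of_all _ fun t => by simp only [smul_smul, mul_comm])
  refine (Lp.eq_zero_iff_ae_eq_zero).mpr ((ae_wMeasure_iff κ).mpr ?_)
  filter_upwards [hae] with t ht
  exact (smul_eq_zero.mp ht).resolve_left (Real.exp_pos _).ne'

theorem antiVolterra_pow_apply_of_mem_weakDerivGraph {n : ℕ} {u g : L2w κ H}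
    (h : (u, g) ∈ weakDerivGraph κ H n) :
    (antiVolterra m hm ^ n) g =
      (((m : ℂ) • antiVolterra m hm - 1 : L2w κ H →L[ℂ] L2w κ H) ^ n) u := by
  refine sub_eq_zero.mp (eq_zero_of_forall_iterate_shiftDeriv hm n fun φ hφ => ?_)
  have hweak : ∫ t in Ioi 0, iteratedDeriv n φ t • u t =
      (-1 : ℝ) ^ n • ∫ t in Ioi 0, φ t • g t := h φ hφ
  rw [(hφ.shiftDeriv_iterate m n).integral_smul_sub,
    integral_iterate_shiftDeriv_smul_antiVolterra_pow hm hφ,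
    integral_iterate_shiftDeriv_smul_sub_one_pow hm hφ, hweak, smul_smul,
    ← mul_pow, neg_one_mul, neg_neg, one_pow, one_smul, sub_self]

end AntiVolterra

/-! ### Initial values -/

section SmoothPrimitives

variable {E : Type*} [NormedAddCommGroup E] [NormedSpace ℝ E] [CompleteSpace E] {v w : ℝ → E}

theorem contDiff_integral {n : ℕ} (hv : ContDiff ℝ n v) :
    ContDiff ℝ (n + 1) fun t => ∫ s in (0 : ℝ)..t, v s := by
  have hderiv := fun t => (hv.continuous.integral_hasStrictDerivAt 0 t).hasDerivAt
  refine contDiff_succ_iff_deriv.mpr ⟨fun t => (hderiv t).differentiableAt, by simp, ?_⟩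
  rwa [funext fun t => (hderiv t).deriv]

theorem prim_derivWithin (hw : ContDiffOn ℝ 1 w (Ici 0)) {t : ℝ} (ht : 0 ≤ t) :
    prim (derivWithin w (Ici 0)) t = w t - w 0 := by
  have hcont : ContinuousOn (derivWithin w (Ici 0)) (Icc 0 t) :=
    (hw.continuousOn_derivWithin (uniqueDiffOn_Ici 0) le_rfl).mono Icc_subset_Ici_self
  rw [prim_eq_intervalIntegral _ ht]
  refine intervalIntegral.integral_eq_sub_of_hasDerivAt_of_le ht
    (hw.continuousOn.mono Icc_subset_Ici_self) (fun s hs => ?_)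
    (hcont.intervalIntegrable_of_Icc ht)
  exact (hw.differentiableOn one_ne_zero s hs.1.le).hasDerivWithinAt.hasDerivAt
    (Ici_mem_nhds hs.1)

end SmoothPrimitives

section InitialValues

variable {H : Type*} [NormedAddCommGroup H] [InnerProductSpace ℂ H] {κ : ℝ} {v w : ℝ → H}

theorem HasPrim.ae_eq_intervalIntegral {y y' : L2w κ H} (h : HasPrim y y')
    (hv : y' =ᵐ[volume.restrict (Ioi (0 : ℝ))] v) :
    y =ᵐ[volume.restrict (Ioi (0 : ℝ))] fun t => ∫ s in (0 : ℝ)..t, v s := by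
  filter_upwards [h, ae_restrict_mem measurableSet_Ioi] with t ht ht0
  rw [ht, prim_congr_ae hv, prim_eq_intervalIntegral _ (le_of_lt ht0)]

variable [CompleteSpace H]

theorem exists_ae_eq_add_prim {y y' : L2w κ H} (h : (y, y') ∈ weakDerivGraph κ H 1) :
    ∃ c, ∀ᵐ t ∂volume.restrict (Ioi (0 : ℝ)), y t = c + prim y' t := by
  have hprim : LocInt (prim y') := locInt_of_continuous (continuous_prim (locInt_L2w y'))
  obtain ⟨c, hc⟩ := exists_ae_eq_const_of_forall_isTest (z := fun t => y t - prim y' t)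
    (fun T => (locInt_L2w y T).sub (hprim T)) fun φ hφ => by
      simp only [smul_sub]
      rw [integral_sub (hφ.deriv.integrable_smul (locInt_L2w y)) (hφ.deriv.integrable_smul hprim),
        mem_weakDerivGraph_one.mp h φ hφ, hφ.integral_deriv_smul_prim (locInt_L2w y'), sub_self]
  exact ⟨c, hc.mono fun t ht => sub_eq_iff_eq_add.mp ht⟩

theorem hasPrim_of_continuousOn {y y' : L2w κ H} (h : (y, y') ∈ weakDerivGraph κ H 1)
    (hw : ContinuousOn w (Ici 0)) (hw0 : w 0 = 0) (hy : y =ᵐ[volume.restrict (Ioi (0 : ℝ))] w) :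
    HasPrim y y' := by
  obtain ⟨c, hc⟩ := exists_ae_eq_add_prim h
  have hcont : ContinuousOn (fun t => c + prim y' t) (Ici 0) :=
    (continuous_const.add (continuous_prim (locInt_L2w y'))).continuousOn
  have heq : EqOn w (fun t => c + prim y' t) (Ici 0) :=
    (Measure.eqOn_open_of_ae_eq (hy.symm.trans hc) isOpen_Ioi (hw.mono Ioi_subset_Ici_self)
      (hcont.mono Ioi_subset_Ici_self)).of_subset_closure hw hcont Ioi_subset_Ici_self
      (closure_Ioi (0 : ℝ)).ge
  have hc0 : c = 0 := by
    simpa only [hw0, prim_zero, add_zero] using (heq self_mem_Ici).symm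
  filter_upwards [hc] with t ht
  rw [ht, hc0, zero_add]

theorem HasPrim.ae_eq_derivWithin {y y' : L2w κ H} (h : HasPrim y y')
    (hw : ContDiffOn ℝ 1 w (Ici 0)) (hw0 : w 0 = 0)
    (hy : y =ᵐ[volume.restrict (Ioi (0 : ℝ))] w) :
    y' =ᵐ[volume.restrict (Ioi (0 : ℝ))] derivWithin w (Ici 0) := by
  have hcont := hw.continuousOn_derivWithin (uniqueDiffOn_Ici 0) le_rfl
  refine ae_eq_of_eqOn_prim (locInt_L2w y')
    (fun T => (hcont.mono Icc_subset_Ici_self).integrableOn_Icc.mono_set Ioc_subset_Icc_self)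
    fun t ht => ?_
  rw [prim_derivWithin hw (le_of_lt ht), hw0, sub_zero]
  exact Measure.eqOn_open_of_ae_eq (h.symm.trans hy) isOpen_Ioi
    (continuous_prim (locInt_L2w y')).continuousOn
    (hw.continuousOn.mono Ioi_subset_Ici_self) ht

theorem hasPrim_of_contDiffOn {u u₁ u₂ u₃ : L2w κ H} (h₁ : (u, u₁) ∈ weakDerivGraph κ H 1)
    (h₂ : (u₁, u₂) ∈ weakDerivGraph κ H 1) (h₃ : (u₂, u₃) ∈ weakDerivGraph κ H 1)
    (hu : u =ᵐ[volume.restrict (Ioi (0 : ℝ))] w) (hw : ContDiffOn ℝ 2 w (Ici 0))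
    (hw0 : ∀ s : ℕ, s ≤ 2 → iteratedDerivWithin s w (Ici 0) 0 = 0) :
    HasPrim u u₁ ∧ HasPrim u₁ u₂ ∧ HasPrim u₂ u₃ := by
  set w₁ := derivWithin w (Ici 0)
  set w₂ := derivWithin w₁ (Ici 0)
  have hzero : w 0 = 0 := hw0 0 (by norm_num)
  have hzero₁ : w₁ 0 = 0 := by simpa only [iteratedDerivWithin_one] using hw0 1 (by norm_num)
  have hzero₂ : w₂ 0 = 0 := by
    have h := hw0 2 le_rfl
    rwa [iteratedDerivWithin_succ, iteratedDerivWithin_one] at h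
  have hw₁ : ContDiffOn ℝ 1 w₁ (Ici 0) :=
    hw.derivWithin (uniqueDiffOn_Ici 0) (by norm_num [one_add_one_eq_two])
  have hprim := hasPrim_of_continuousOn h₁ hw.continuousOn hzero hu
  have hu₁ := hprim.ae_eq_derivWithin (hw.of_le one_le_two) hzero hu
  have hprim₁ := hasPrim_of_continuousOn h₂ hw₁.continuousOn hzero₁ hu₁
  have hu₂ := hprim₁.ae_eq_derivWithin hw₁ hzero₁ hu₁
  exact ⟨hprim, hprim₁, hasPrim_of_continuousOn h₃
    (hw₁.continuousOn_derivWithin (uniqueDiffOn_Ici 0) le_rfl) hzero₂ hu₂⟩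

theorem exists_contDiffOn_of_hasPrim {u u₁ u₂ u₃ : L2w κ H} (h₁ : HasPrim u u₁)
    (h₂ : HasPrim u₁ u₂) (h₃ : HasPrim u₂ u₃) :
    ∃ w : ℝ → H, w =ᵐ[wMeasure κ] u ∧ ContDiffOn ℝ 2 w (Ici 0) ∧
      ∀ s : ℕ, s ≤ 2 → iteratedDerivWithin s w (Ici 0) 0 = 0 := by
  set w₂ : ℝ → H := prim u₃
  have hw₂ : Continuous w₂ := continuous_prim (locInt_L2w u₃)
  set w₁ : ℝ → H := fun t => ∫ s in (0 : ℝ)..t, w₂ s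
  have hw₁ : ContDiff ℝ 1 w₁ := by simpa using contDiff_integral (n := 0) (contDiff_zero.mpr hw₂)
  set w : ℝ → H := fun t => ∫ s in (0 : ℝ)..t, w₁ s
  have hw : ContDiff ℝ 2 w := by
    simpa only [Nat.cast_one, one_add_one_eq_two] using contDiff_integral (n := 1) hw₁
  have hderiv : deriv w = w₁ := funext fun t => hw₁.continuous.deriv_integral w₁ 0 t
  have hderiv₁ : deriv w₁ = w₂ := funext fun t => hw₂.deriv_integral w₂ 0 t
  refine ⟨w, (ae_wMeasure_iff κ).mpr ?_, hw.contDiffOn, fun s hs => ?_⟩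
  · exact (h₁.ae_eq_intervalIntegral (h₂.ae_eq_intervalIntegral h₃)).symm
  · rw [iteratedDerivWithin_eq_iteratedDeriv (uniqueDiffOn_Ici 0)
      (hw.of_le (mod_cast hs)).contDiffAt self_mem_Ici]
    interval_cases s
    · exact intervalIntegral.integral_same
    · rw [iteratedDeriv_one, hderiv]
      exact intervalIntegral.integral_same
    · rw [iteratedDeriv_succ, iteratedDeriv_one, hderiv, hderiv₁]
      exact prim_zero u₃

end InitialValues

/-! ### Graphs of the operators of the problem -/

section Graphs

section OpPow

variable {X : Type*} [NormedAddCommGroup X] [NormedSpace ℂ X] {f g : X →ₗ.[ℂ] X} {x y z : X}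

theorem mem_add_graph (hf : (x, y) ∈ f.graph) (hg : (x, z) ∈ g.graph) :
    (x, y + z) ∈ (f + g).graph := by
  obtain ⟨a, ha, rfl⟩ := (LinearPMap.mem_graph_iff f).mp hf
  obtain ⟨b, hb, rfl⟩ := (LinearPMap.mem_graph_iff g).mp hg
  obtain rfl : (a : X) = x := ha
  have hag : (a : X) ∈ g.domain := (show (b : X) = a from hb) ▸ b.2
  obtain rfl : b = ⟨a, hag⟩ := Subtype.ext hb
  exact (LinearPMap.mem_graph_iff _).mpr ⟨⟨a, a.2, hag⟩, rfl, rfl⟩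

theorem mem_neg_graph (hf : (x, y) ∈ f.graph) : (x, -y) ∈ (-f).graph := by
  obtain ⟨a, rfl, rfl⟩ := (LinearPMap.mem_graph_iff f).mp hf
  exact (LinearPMap.mem_graph_iff _).mpr ⟨a, rfl, rfl⟩

theorem mem_opPow_graph_of_commute {R Z : X →L[ℂ] X} (hf : ∀ x, (R x, Z x) ∈ f.graph)
    (hRZ : Commute R Z) (n : ℕ) (x : X) : ((R ^ n) x, (Z ^ n) x) ∈ (opPow f n).graph := by
  induction n generalizing x with
  | zero => exact (opPow f 0).mem_graph ⟨x, trivial⟩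
  | succ n ih =>
    rw [opPow, mem_opComp_graph]
    refine ⟨(Z ^ n) (R x), ih (R x), ?_⟩
    rw [← mul_apply_eq_comp, ← (hRZ.pow_right n).eq, pow_succ']
    exact hf ((Z ^ n) x)

theorem pow_apply_mem_opPow_graph {R : X →L[ℂ] X} (hf : ∀ x, (R x, x) ∈ f.graph) (n : ℕ) (x : X) :
    ((R ^ n) x, x) ∈ (opPow f n).graph := by
  simpa only [one_pow, one_apply_eq_self] using
    mem_opPow_graph_of_commute (Z := 1) hf (Commute.one_right R) n x

theorem mem_opPow_graph_iff {B : X →L[ℂ] X} (hB : ∀ x y, (x, y) ∈ f.graph ↔ x = B y) (n : ℕ)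
    (x y : X) : (x, y) ∈ (opPow f n).graph ↔ x = (B ^ n) y := by
  constructor
  · intro h
    induction n generalizing y with
    | zero =>
      obtain ⟨z, rfl, rfl⟩ := (LinearPMap.mem_graph_iff _).mp h
      rfl
    | succ n ih =>
      rw [opPow, mem_opComp_graph] at h
      obtain ⟨z, hxz, hzy⟩ := h
      rw [ih z hxz, (hB z y).mp hzy, pow_succ, mul_apply_eq_comp]
  · rintro rfl
    exact pow_apply_mem_opPow_graph (fun x => (hB _ _).mpr rfl) n y

end OpPow

variable {H : Type*} [NormedAddCommGroup H] [InnerProductSpace ℂ H] {κ : ℝ} {A : H →ₗ.[ℂ] H}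
  {B : H →L[ℂ] H}

theorem mem_pointwiseGraph_iff (hB : ∀ x y, (x, y) ∈ A.graph ↔ x = B y) {u v : L2w κ H} :
    (u, v) ∈ pointwiseGraph κ A ↔ u = lift κ B v := by
  refine Iff.trans (ae_wMeasure_iff κ) ⟨fun h => L2w_ext ?_, ?_⟩
  · filter_upwards [h, lift_ae B v] with t hgraph hlift
    rw [hlift, (hB _ _).mp hgraph]
  · rintro rfl
    filter_upwards [lift_ae B v] with t hlift
    exact (hB _ _).mpr hlift

theorem lift_pow (B : H →L[ℂ] H) (n : ℕ) : lift κ (B ^ n) = lift κ B ^ n := by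
  induction n with
  | zero =>
    ext1 u
    exact L2w_ext (lift_ae (B ^ 0) u)
  | succ n ih =>
    ext1 u
    refine L2w_ext ?_
    rw [pow_succ (lift κ B), ← ih, mul_apply_eq_comp]
    filter_upwards [lift_ae (B ^ (n + 1)) u, lift_ae (B ^ n) (lift κ B u), lift_ae B u]
      with t hsucc hn hone
    rw [hsucc, hn, hone, pow_succ, mul_apply_eq_comp]

theorem mem_pointwiseGraph_opPow_iff (hB : ∀ x y, (x, y) ∈ A.graph ↔ x = B y) {n : ℕ}
    {u v : L2w κ H} : (u, v) ∈ pointwiseGraph κ (opPow A n) ↔ u = (lift κ B ^ n) v := by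
  rw [mem_pointwiseGraph_iff (mem_opPow_graph_iff hB n), lift_pow]

variable [CompleteSpace H]

theorem mem_deriv_add_graph (hB : ∀ x y, (x, y) ∈ A.graph ↔ x = B y) {y g a : L2w κ H}
    (hy : (y, g) ∈ weakDerivGraph κ H 1) (ha : y = lift κ B a) :
    (y, g + a) ∈ (weakDeriv κ H 1 + pointwiseOp κ A).graph := by
  refine mem_add_graph ?_ ?_
  · rwa [weakDeriv_graph]
  · rwa [pointwiseOp_graph, mem_pointwiseGraph_iff hB]

theorem mem_neg_deriv_add_graph (hB : ∀ x y, (x, y) ∈ A.graph ↔ x = B y) {y g a : L2w κ H}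
    (hy : (y, g) ∈ weakDerivGraph κ H 1) (ha : y = lift κ B a) :
    (y, -g + a) ∈ (-weakDeriv κ H 1 + pointwiseOp κ A).graph := by
  refine mem_add_graph (mem_neg_graph ?_) ?_
  · rwa [weakDeriv_graph]
  · rwa [pointwiseOp_graph, mem_pointwiseGraph_iff hB]

end Graphs

/-! ### The space `W⁴_{2,κ}` -/

namespace W4

variable {H : Type*} [NormedAddCommGroup H] [InnerProductSpace ℂ H] {κ : ℝ} {A : H →ₗ.[ℂ] H}

theorem ext_toL2 {u v : W4 A κ} (h : toL2 u = toL2 v) : u = v :=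
  Subtype.ext h

theorem norm_d4_le (u : W4 A κ) : ‖d4 u‖ ≤ ‖u‖ := by
  rw [norm_eq]
  exact Real.le_sqrt_of_sq_le (le_add_of_nonneg_right (sq_nonneg _))

theorem norm_a4_le (u : W4 A κ) : ‖a4 u‖ ≤ ‖u‖ := by
  rw [norm_eq]
  exact Real.le_sqrt_of_sq_le (le_add_of_nonneg_left (sq_nonneg _))

theorem norm_le (u : W4 A κ) : ‖u‖ ≤ ‖d4 u‖ + ‖a4 u‖ := by
  rw [norm_eq]
  exact Real.sqrt_le_iff.mpr
    ⟨by positivity, by nlinarith [norm_nonneg (d4 u), norm_nonneg (a4 u)]⟩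

/-- The fourth derivative as a bounded operator. -/
def d4L : W4 A κ →L[ℂ] L2w κ H := d4.mkContinuous 1 fun u => by rw [one_mul]; exact norm_d4_le u

/-- The operator `u ↦ A⁴ u` as a bounded operator. -/
def a4L : W4 A κ →L[ℂ] L2w κ H := a4.mkContinuous 1 fun u => by rw [one_mul]; exact norm_a4_le u

theorem mem_graph_a4 (u : W4 A κ) : (toL2 u, a4 u) ∈ pointwiseGraph κ (opPow A 4) := by
  rw [← pointwiseOp_graph]
  exact LinearPMap.mem_graph _ (Submodule.inclusion inf_le_right u)

variable [CompleteSpace H]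

theorem mem_graph_d4 (u : W4 A κ) : (toL2 u, d4 u) ∈ weakDerivGraph κ H 4 := by
  rw [← weakDeriv_graph]
  exact LinearPMap.mem_graph _ (Submodule.inclusion inf_le_left u)

theorem exists_continuousLinearMap {T D C : L2w κ H →L[ℂ] L2w κ H}
    (hD : ∀ f, (T f, D f) ∈ weakDerivGraph κ H 4)
    (hC : ∀ f, (T f, C f) ∈ pointwiseGraph κ (opPow A 4)) :
    ∃ G : L2w κ H →L[ℂ] W4 A κ, ∀ f, toL2 (G f) = T f := by
  simp only [← weakDeriv_graph, ← pointwiseOp_graph] at hD hC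
  let G : L2w κ H →ₗ[ℂ] W4 A κ :=
    LinearMap.codRestrict ((weakDeriv κ H 4).domain ⊓ (pointwiseOp κ (opPow A 4)).domain)
      T.toLinearMap fun f =>
        ⟨LinearPMap.mem_domain_of_mem_graph (hD f), LinearPMap.mem_domain_of_mem_graph (hC f)⟩
  refine ⟨G.mkContinuous (‖D‖ + ‖C‖) fun f => ?_, fun f => rfl⟩
  have hd4 : d4 (G f) = D f :=
    (weakDeriv κ H 4).mem_graph_snd_inj (LinearPMap.mem_graph _ _) (hD f) rfl
  have ha4 : a4 (G f) = C f :=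
    (pointwiseOp κ (opPow A 4)).mem_graph_snd_inj (LinearPMap.mem_graph _ _) (hC f) rfl
  calc ‖G f‖ ≤ ‖D f‖ + ‖C f‖ := by
        rw [← hd4, ← ha4]
        exact norm_le (G f)
    _ ≤ (‖D‖ + ‖C‖) * ‖f‖ := by
      rw [add_mul]
      exact add_le_add (D.le_opNorm f) (C.le_opNorm f)

end W4

/-! ### The inverses of `d/dt + A` and `-d/dt + A` -/

section Resolvents

theorem pow_mul_pow_succ_of_commute {M : Type*} [Monoid M] {a b : M} (h : Commute a b) (i j : ℕ) :
    a ^ i * b ^ (j + 1) = b * (a ^ i * b ^ j) := by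
  rw [pow_succ', ← mul_assoc, (h.pow_left i).eq, mul_assoc]

variable {H : Type*} [NormedAddCommGroup H] [InnerProductSpace ℂ H] [CompleteSpace H] {κ m : ℝ}
  {hm : 0 < 2 * m + κ} {hm' : 0 < 2 * (m - κ) + κ} {L R S : L2w κ H →L[ℂ] L2w κ H}

theorem mem_zeroInitial_iff_hasPrim {k : L2w κ H} :
    k ∈ zeroInitial (volterra m hm) R S m ↔ HasPrim (R k) (S k - k) :=
  mem_zeroInitial_iff.trans (hasPrim_iff_volterra_eq hm).symm

namespace IsSumResolvent

theorem hasPrim (h : IsSumResolvent L (volterra m hm) m R S) (f : L2w κ H) :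
    HasPrim (R f) (f - S f) := by
  have hR : volterra m hm (f - S f + (m : ℂ) • R f) = R f := (DFunLike.congr_fun h.eq_mul f).symm
  simpa only [hR, add_sub_cancel_right] using hasPrim_volterra hm (f - S f + (m : ℂ) • R f)

theorem hasPrim_pow_mul (h : IsSumResolvent L (volterra m hm) m R S) (hRS : Commute R S)
    (i j : ℕ) (f : L2w κ H) :
    HasPrim ((R ^ (i + 1) * (1 - S) ^ j : L2w κ H →L[ℂ] L2w κ H) f)
      ((R ^ i * (1 - S) ^ (j + 1) : L2w κ H →L[ℂ] L2w κ H) f) := by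
  rw [pow_mul_pow_succ_of_commute ((Commute.one_right R).sub_right hRS), pow_succ', mul_assoc]
  exact h.hasPrim ((R ^ i * (1 - S) ^ j : L2w κ H →L[ℂ] L2w κ H) f)

theorem mem_weakDerivGraph (h : IsSumResolvent L (antiVolterra m hm') m R S) (f : L2w κ H) :
    (R f, S f - f) ∈ weakDerivGraph κ H 1 := by
  have hR : antiVolterra m hm' (f - S f + (m : ℂ) • R f) = R f :=
    (DFunLike.congr_fun h.eq_mul f).symm
  have hmem := antiVolterra_mem_weakDerivGraph hm' (f - S f + (m : ℂ) • R f)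
  rw [hR] at hmem
  convert hmem using 2
  abel

theorem mem_weakDerivGraph_pow_mul (h : IsSumResolvent L (antiVolterra m hm') m R S)
    (hRS : Commute R S) (i j : ℕ) (f : L2w κ H) :
    ((R ^ (i + 1) * (S - 1) ^ j : L2w κ H →L[ℂ] L2w κ H) f,
      (R ^ i * (S - 1) ^ (j + 1) : L2w κ H →L[ℂ] L2w κ H) f) ∈ weakDerivGraph κ H 1 := by
  rw [pow_mul_pow_succ_of_commute (hRS.sub_right (Commute.one_right R)), pow_succ', mul_assoc]
  exact h.mem_weakDerivGraph ((R ^ i * (S - 1) ^ j : L2w κ H →L[ℂ] L2w κ H) f)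

theorem mem_zeroInitial_of_contDiffOn (h : IsSumResolvent L (antiVolterra m hm') m R S)
    (hRS : Commute R S) {f : L2w κ H} {w : ℝ → H}
    (hu : (R ^ 4) f =ᵐ[volume.restrict (Ioi (0 : ℝ))] w) (hw : ContDiffOn ℝ 2 w (Ici 0))
    (hw0 : ∀ s : ℕ, s ≤ 2 → iteratedDerivWithin s w (Ici 0) 0 = 0) :
    (R ^ 3) f ∈ zeroInitial (volterra m hm) R S m ∧
      (R ^ 2 * (S - 1) : L2w κ H →L[ℂ] L2w κ H) f ∈ zeroInitial (volterra m hm) R S m ∧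
      (R * (S - 1) ^ 2 : L2w κ H →L[ℂ] L2w κ H) f ∈ zeroInitial (volterra m hm) R S m := by
  obtain ⟨h₁, h₂, h₃⟩ := hasPrim_of_contDiffOn (h.mem_weakDerivGraph_pow_mul hRS 3 0 f)
    (h.mem_weakDerivGraph_pow_mul hRS 2 1 f) (h.mem_weakDerivGraph_pow_mul hRS 1 2 f) hu hw hw0
  have hstep : ∀ i j, HasPrim ((R ^ (i + 1) * (S - 1) ^ j : L2w κ H →L[ℂ] L2w κ H) f)
      ((R ^ i * (S - 1) ^ (j + 1) : L2w κ H →L[ℂ] L2w κ H) f) →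
      (R ^ i * (S - 1) ^ j : L2w κ H →L[ℂ] L2w κ H) f ∈ zeroInitial (volterra m hm) R S m := by
    intro i j hprim
    rw [pow_mul_pow_succ_of_commute (hRS.sub_right (Commute.one_right R)), pow_succ',
      mul_assoc] at hprim
    exact mem_zeroInitial_iff_hasPrim.mpr hprim
  exact ⟨hstep 3 0 h₁, by simpa only [pow_one] using hstep 2 1 h₂,
    by simpa only [pow_one] using hstep 1 2 h₃⟩

end IsSumResolvent

end Resolvents

/-! ### The isomorphism -/

section Isomorphism

variable {H : Type*} [NormedAddCommGroup H] [InnerProductSpace ℂ H] [CompleteSpace H] {κ m : ℝ}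
  {A : H →ₗ.[ℂ] H} {B : H →L[ℂ] H} {hm : 0 < 2 * m + κ} {hm' : 0 < 2 * (m - κ) + κ}
  {R S R' S' : L2w κ H →L[ℂ] L2w κ H}

theorem W4.exists_toL2_eq_pow_apply (hB : ∀ x y, (x, y) ∈ A.graph ↔ x = B y) (hB0 : 0 ≤ B)
    (h : IsSumResolvent (lift κ B) (antiVolterra m hm') m R S) :
    ∃ p : W4 A κ →L[ℂ] L2w κ H, ∀ u, toL2 u = (R ^ 4) (p u) := by
  have hinj := lift_injective (κ := κ) (injective_of_mem_graph_iff hB)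
  have hBV := commute_lift_antiVolterra hm' hB0
  obtain ⟨C, D, hCD⟩ := exists_eq_pow_apply (h.commute_self hinj hBV) 4
  refine ⟨C ∘L a4L + D ∘L d4L, fun u => hCD _ _ _ ?_ (h.pow_apply_eq_of_pow_apply_eq hinj hBV
    (antiVolterra_pow_apply_of_mem_weakDerivGraph hm' u.mem_graph_d4))⟩
  rw [(mem_pointwiseGraph_opPow_iff hB).mp u.mem_graph_a4, h.pow_eq_pow_mul hinj hBV]
  rfl

theorem IsSumResolvent.mem_deriv_add_graph (hB : ∀ x y, (x, y) ∈ A.graph ↔ x = B y)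
    (h : IsSumResolvent (lift κ B) (volterra m hm) m R S) (f : L2w κ H) :
    (R f, f) ∈ (weakDeriv κ H 1 + pointwiseOp κ A).graph := by
  simpa only [sub_add_cancel] using WeightedODE.mem_deriv_add_graph hB (a := S f)
    (h.hasPrim f).mem_weakDerivGraph (DFunLike.congr_fun h.mul_eq f).symm

theorem IsSumResolvent.mem_neg_deriv_add_graph (hB : ∀ x y, (x, y) ∈ A.graph ↔ x = B y)
    (h : IsSumResolvent (lift κ B) (antiVolterra m hm') m R S) (f : L2w κ H) :
    (R f, f) ∈ (-weakDeriv κ H 1 + pointwiseOp κ A).graph := by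
  simpa only [neg_sub, sub_add_cancel] using WeightedODE.mem_neg_deriv_add_graph hB (a := S f)
    (h.mem_weakDerivGraph f) (DFunLike.congr_fun h.mul_eq f).symm

theorem mem_P0_graph_pow_four (hB : ∀ x y, (x, y) ∈ A.graph ↔ x = B y)
    (h : IsSumResolvent (lift κ B) (antiVolterra m hm') m R S) (hRS : Commute R S)
    (f : L2w κ H) :
    ((R ^ 4) f, ((2 * S - 1 : L2w κ H →L[ℂ] L2w κ H) ^ 3) f) ∈ (P0 A κ).graph := by
  have hfwd : ∀ k, (R k, (2 * S - 1 : L2w κ H →L[ℂ] L2w κ H) k) ∈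
      (weakDeriv κ H 1 + pointwiseOp κ A).graph := fun k => by
    convert mem_deriv_add_graph hB (h.mem_weakDerivGraph k)
      (DFunLike.congr_fun h.mul_eq k).symm using 2
    rw [two_mul]
    exact (sub_add_eq_add_sub _ _ _).symm
  have hRZ : Commute R (2 * S - 1) :=
    ((Commute.ofNat_right R 2).mul_right hRS).sub_right (Commute.one_right R)
  rw [P0, mem_opComp_graph]
  refine ⟨_, mem_opPow_graph_of_commute hfwd hRZ 3 (R f), ?_⟩
  rw [← mul_apply_eq_comp, ← (hRZ.pow_right 3).eq]
  exact h.mem_neg_deriv_add_graph hB _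

theorem mem_P0_graph_pow_three_apply (hB : ∀ x y, (x, y) ∈ A.graph ↔ x = B y)
    (h : IsSumResolvent (lift κ B) (volterra m hm) m R S)
    (h' : IsSumResolvent (lift κ B) (antiVolterra m hm') m R' S') (f : L2w κ H) :
    ((R ^ 3) (R' f), f) ∈ (P0 A κ).graph := by
  rw [P0, mem_opComp_graph]
  refine ⟨R' f, ?_, h'.mem_neg_deriv_add_graph hB f⟩
  have hinv := h.mem_deriv_add_graph hB
  exact pow_apply_mem_opPow_graph hinv 3 (R' f)

theorem hasPrim_pow_three_apply (h : IsSumResolvent (lift κ B) (volterra m hm) m R S)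
    (hRS : Commute R S) (f : L2w κ H) :
    HasPrim ((R ^ 3) f) ((R ^ 2 * (1 - S) : L2w κ H →L[ℂ] L2w κ H) f) ∧
      HasPrim ((R ^ 2 * (1 - S) : L2w κ H →L[ℂ] L2w κ H) f)
        ((R * (1 - S) ^ 2 : L2w κ H →L[ℂ] L2w κ H) f) ∧
      HasPrim ((R * (1 - S) ^ 2 : L2w κ H →L[ℂ] L2w κ H) f)
        (((1 - S : L2w κ H →L[ℂ] L2w κ H) ^ 3) f) :=
  ⟨by simpa only [zero_add, pow_zero, mul_one, pow_one] using h.hasPrim_pow_mul hRS 2 0 f,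
    by simpa only [pow_one] using h.hasPrim_pow_mul hRS 1 1 f,
    by simpa only [zero_add, pow_zero, one_mul, pow_one] using h.hasPrim_pow_mul hRS 0 2 f⟩

theorem exists_mem_weakDerivGraph_four (hBS : Commute (lift κ B) S)
    (h : IsSumResolvent (lift κ B) (volterra m hm) m R S) (hRS : Commute R S)
    (h' : IsSumResolvent (lift κ B) (antiVolterra m hm') m R' S') :
    ∃ D : L2w κ H →L[ℂ] L2w κ H, ∀ f, ((R ^ 3) (R' f), D f) ∈ weakDerivGraph κ H 4 := by
  set N : L2w κ H →L[ℂ] L2w κ H := 1 - S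
  set K := (1 + N + N ^ 2) * S'
  have hSR : S * R' = R * S' := by rw [← h'.mul_eq, ← mul_assoc, ← hBS.eq, h.mul_eq]
  have hN : N ^ 3 * R' = R' - R * K := by
    have hRN : Commute R (1 + N + N ^ 2) := by
      have hRN := (Commute.one_right R).sub_right hRS
      exact ((Commute.one_right R).add_right hRN).add_right (hRN.pow_right 2)
    calc N ^ 3 * R' = R' - (1 + N + N ^ 2) * (S * R') := by simp only [N]; noncomm_ring
      _ = R' - R * K := by rw [hSR, ← mul_assoc, ← hRN.eq, mul_assoc]
  refine ⟨S' - 1 - N * K, fun f => ?_⟩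
  obtain ⟨h₁, h₂, h₃⟩ := hasPrim_pow_three_apply h hRS (R' f)
  have h₄ : ((N ^ 3) (R' f), (S' - 1 - N * K) f) ∈ weakDerivGraph κ H 1 := by
    rw [← mul_apply_eq_comp, hN]
    exact sub_mem (h'.mem_weakDerivGraph f) (h.hasPrim (K f)).mem_weakDerivGraph
  exact mem_weakDerivGraph_succ h₁.mem_weakDerivGraph (mem_weakDerivGraph_succ
    h₂.mem_weakDerivGraph (mem_weakDerivGraph_succ h₃.mem_weakDerivGraph h₄))

theorem exists_continuousLinearMap_mem_W40 (hB : ∀ x y, (x, y) ∈ A.graph ↔ x = B y)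
    (h : IsSumResolvent (lift κ B) (volterra m hm) m R S)
    (h' : IsSumResolvent (lift κ B) (antiVolterra m hm') m R' S') :
    ∃ G : L2w κ H →L[ℂ] W4 A κ, ∀ f, W4.toL2 (G f) = (R ^ 3) (R' f) ∧ G f ∈ W40 A κ := by
  have hinj := lift_injective (κ := κ) (injective_of_mem_graph_iff hB)
  have hBV := commute_lift_volterra hm B
  have hBS := h.commute_right hinj (Commute.refl _) hBV
  have hRS := h.commute_self hinj hBV
  obtain ⟨D, hD⟩ := exists_mem_weakDerivGraph_four hBS h hRS h'
  have hA4 : R ^ 3 * R' = lift κ B ^ 4 * (S ^ 3 * S') := by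
    rw [h.pow_eq_pow_mul hinj hBV, (hBS.pow_pow 3 3).symm.eq, ← h'.mul_eq, mul_assoc,
      ← mul_assoc (S ^ 3), (hBS.pow_right 3).symm.eq, pow_succ _ 3, mul_assoc, mul_assoc]
  obtain ⟨G, hG⟩ := W4.exists_continuousLinearMap (A := A) (T := R ^ 3 * R') hD fun f =>
    (mem_pointwiseGraph_opPow_iff hB).mpr (DFunLike.congr_fun hA4 f)
  refine ⟨G, fun f => ⟨hG f, ?_⟩⟩
  obtain ⟨h₁, h₂, h₃⟩ := hasPrim_pow_three_apply h hRS (R' f)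
  obtain ⟨w, hw, hsmooth, hzero⟩ := exists_contDiffOn_of_hasPrim h₁ h₂ h₃
  exact ⟨w, by rwa [hG], hsmooth, hzero⟩

theorem pow_three_apply_eq_of_mem_W40 (hB : ∀ x y, (x, y) ∈ A.graph ↔ x = B y) (hB0 : 0 ≤ B)
    (h : IsSumResolvent (lift κ B) (volterra m hm) m R S)
    (h' : IsSumResolvent (lift κ B) (antiVolterra m hm') m R' S') {u : W4 A κ} (hu : u ∈ W40 A κ)
    {f : L2w κ H} (huf : W4.toL2 u = (R' ^ 4) f) :
    (R ^ 3) (R' (((2 * S' - 1 : L2w κ H →L[ℂ] L2w κ H) ^ 3) f)) = W4.toL2 u := by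
  have hinj := lift_injective (κ := κ) (injective_of_mem_graph_iff hB)
  have hBV := commute_lift_antiVolterra hm' hB0
  have hRS := h'.commute_self hinj hBV
  obtain ⟨w, hw, hsmooth, hzero⟩ := hu
  rw [huf] at hw ⊢
  obtain ⟨h₀, h₁, h₂⟩ := h'.mem_zeroInitial_of_contDiffOn (hm := hm) hRS
    (EventuallyEq.symm ((ae_wMeasure_iff κ).mp hw)) hsmooth hzero
  exact h.pow_three_apply_eq hinj (commute_lift_volterra hm B) h'.mul_eq
    (h'.commute_left (Commute.refl _) hBV) (h'.commute_right hinj (Commute.refl _) hBV)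
    hRS h₀ h₁ h₂

theorem exists_continuousLinearEquiv (hB : ∀ x y, (x, y) ∈ A.graph ↔ x = B y) (hB0 : 0 ≤ B)
    (h : IsSumResolvent (lift κ B) (volterra m hm) m R S)
    (h' : IsSumResolvent (lift κ B) (antiVolterra m hm') m R' S') :
    ∃ P : W40 A κ ≃L[ℂ] L2w κ H, ∀ u : W40 A κ,
      (W4.toL2 (u : W4 A κ), P u) ∈ (P0 A κ).graph := by
  have hRS := h'.commute_self (lift_injective (injective_of_mem_graph_iff hB))
    (commute_lift_antiVolterra hm' hB0)
  obtain ⟨p, hp⟩ := W4.exists_toL2_eq_pow_apply hB hB0 h'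
  obtain ⟨G, hG⟩ := exists_continuousLinearMap_mem_W40 hB h h'
  let P : W40 A κ →L[ℂ] L2w κ H :=
    ((2 * S' - 1) ^ 3 : L2w κ H →L[ℂ] L2w κ H) ∘L p ∘L (W40 A κ).subtypeL
  let Q : L2w κ H →L[ℂ] W40 A κ := G.codRestrict (W40 A κ) fun f => (hG f).2
  have hP : ∀ u : W40 A κ, (W4.toL2 (u : W4 A κ), P u) ∈ (P0 A κ).graph := fun u => by
    rw [hp]
    exact mem_P0_graph_pow_four hB h' hRS (p u)
  have hQP : Function.LeftInverse Q P := fun u => Subtype.ext <| W4.ext_toL2 <|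
    (hG (P u)).1.trans (pow_three_apply_eq_of_mem_W40 hB hB0 h h' u.2 (hp u))
  have hPQ : Function.RightInverse Q P := fun f =>
    (P0 A κ).mem_graph_snd_inj (hP (Q f)) (mem_P0_graph_pow_three_apply hB h h' f) (hG f).1
  exact ⟨ContinuousLinearEquiv.equivOfInverse P Q hQP hPQ, hP⟩

theorem exists_isSumResolvent_lift (hA : IsSelfAdjoint A) (hm0 : 0 < m)
    (hA_ge : ∀ x : A.domain, m * ‖(x : H)‖ ^ 2 ≤ (inner ℂ (A x) (x : H)).re)
    (hB : ∀ x y, (x, y) ∈ A.graph ↔ x = B y) {V : L2w κ H →L[ℂ] L2w κ H} (hV : IsAccretive V)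
    (hBV : Commute (lift κ B) V) :
    ∃ R S : L2w κ H →L[ℂ] L2w κ H, IsSumResolvent (lift κ B) V m R S := by
  refine hV.exists_isSumResolvent (lift_nonneg (nonneg_of_mem_graph_iff hA hm0.le hA_ge hB)) ?_
    hBV (lift_injective (injective_of_mem_graph_iff hB))
  rw [← lift_one_sub_smul]
  exact lift_nonneg (one_sub_smul_nonneg_of_mem_graph_iff hA hm0 hA_ge hB)

end Isomorphism

end WeightedODE

end

theorem theorem1_general {H : Type*} [NormedAddCommGroup H] [InnerProductSpace ℂ H]
    [CompleteSpace H] (A : H →ₗ.[ℂ] H) (hA : IsSelfAdjoint A) (lam0 : ℝ)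
    (hA_ge : ∀ x : A.domain, lam0 * ‖(x : H)‖ ^ 2 ≤ (inner ℂ (A x) (x : H)).re)
    (κ : ℝ) (hκ : |κ| < 2 * lam0) :
    ∃ P : WeightedODE.W40 A κ ≃L[ℂ] WeightedODE.L2w κ H,
      ∀ u : WeightedODE.W40 A κ,
        ∃ hu : WeightedODE.W4.toL2 (u : WeightedODE.W4 A κ) ∈ (WeightedODE.P0 A κ).domain,
          P u = WeightedODE.P0 A κ ⟨WeightedODE.W4.toL2 (u : WeightedODE.W4 A κ), hu⟩ := by
  open WeightedODE in
  have hlam0 : 0 < lam0 := by linarith [abs_nonneg κ]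
  have hplus : 0 < 2 * lam0 + κ := by linarith [neg_lt_of_abs_lt hκ]
  have hminus : 0 < 2 * (lam0 - κ) + κ := by linarith [lt_of_abs_lt hκ]
  obtain ⟨B, hB⟩ := exists_bounded_inverse hA hlam0 (mul_norm_le_norm_apply hA_ge)
  have hB0 := nonneg_of_mem_graph_iff hA hlam0.le hA_ge hB
  obtain ⟨R, S, h⟩ := exists_isSumResolvent_lift hA hlam0 hA_ge hB (isAccretive_volterra hplus)
    (commute_lift_volterra hplus B)
  obtain ⟨R', S', h'⟩ := exists_isSumResolvent_lift hA hlam0 hA_ge hB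
    (isAccretive_antiVolterra hminus) (commute_lift_antiVolterra hminus hB0)
  obtain ⟨P, hP⟩ := exists_continuousLinearEquiv hB hB0 h h'
  refine ⟨P, fun u => ?_⟩
  have hu := LinearPMap.mem_domain_of_mem_graph (hP u)
  exact ⟨hu, (P0 A κ).mem_graph_snd_inj (hP u) (LinearPMap.mem_graph _ ⟨_, hu⟩) rfl⟩

theorem theorem1 {H : Type*} [NormedAddCommGroup H] [InnerProductSpace ℂ H] [CompleteSpace H]
    [TopologicalSpace.SeparableSpace H]
    (A : H →ₗ.[ℂ] H) (hA : IsSelfAdjoint A)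
    (lam0 : ℝ) (hlam0 : 0 < lam0)
    (hA_ge : ∀ x : A.domain, lam0 * ‖(x : H)‖ ^ 2 ≤ (inner ℂ (A x) (x : H)).re)
    (κ : ℝ) (hκ : |κ| < 2 * lam0) :
    ∃ P : WeightedODE.W40 A κ ≃L[ℂ] WeightedODE.L2w κ H,
      ∀ u : WeightedODE.W40 A κ,
        ∃ hu : WeightedODE.W4.toL2 (u : WeightedODE.W4 A κ) ∈ (WeightedODE.P0 A κ).domain,
          P u = WeightedODE.P0 A κ ⟨WeightedODE.W4.toL2 (u : WeightedODE.W4 A κ), hu⟩ := by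
  exact theorem1_general A hA lam0 hA_ge κ hκ
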